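/- Let $G$ be a countable, residually finite, non-amenable group. Let $G$ act on $2^G$ (product topology) by $(g\cdot x)(h)=x(g^{-1}h)$. A subshift is a nonempty closed $G$-invariant set $S\subseteq 2^G$; it is Toeplitz if $S=\overline{G\cdot x}$ for some $x\in 2^G$ that is continuous as a map from $G$ with the profinite topology to the discrete space $\{0,1\}$, and it is free if $g\cdot x\neq x$ for all $x\in S$ and all $g\neq 1_G$. Let $X$ be the set of free Toeplitz $G$-subshifts, with the Borel $\sigma$-algebra of the Vietoris topology, and let $E$ be the relation of topological conjugacy on $X$: $S\mathrel{E}T$ iff there is a $G$-equivariant homeomorphism $S\to T$. Then $E$ is not hyperfinite, i.e. it is not the union of an increasing sequence of Borel equivalence relations on $X$ with finite classes. Moreover, there is a Borel probability measure $\mu$ on $X$ such that $E$ is not $\mu$-amenable, i.e. there is no sequence of nonnegative Borel functions $\lambda^n\colon E\to\mathbb R$ such that $\sum_{z\in[x]_E}\lambda^n(x,z)=1$ for all $n$ and all $x\in X$ and, for $\mu$-almost every $x$, $\lim_{n\to\infty}\sum_{z\in[x]_E}|\lambda^n(x,z)-\lambda^n(y,z)|=0$ for all $y\in[x]_E$.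 -/

import Mathlib

open Filter Topology MeasureTheory TopologicalSpace
open scoped ENNReal

section Group

/-- `G` is amenable: there is a left-invariant mean on `ℓ^∞(G)`, that is, a positive normalized
linear functional invariant under all left translations `f ↦ (h ↦ f (g⁻¹ h))`. -/
def IsAmenableGroup (G : Type*) [Group G] : Prop :=
  ∃ m : lp (fun _ : G => ℝ) ∞ →ₗ[ℝ] ℝ,
    m 1 = 1 ∧
    (∀ f : lp (fun _ : G => ℝ) ∞, (∀ h, 0 ≤ f h) → 0 ≤ m f) ∧
    ∀ (g : G) (f f' : lp (fun _ : G => ℝ) ∞), (∀ h, f' h = f (g⁻¹ * h)) → m f' = m f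

/-- The profinite topology on `G`: the cosets `g H` of finite index subgroups `H` form a basis of
neighbourhoods at `g`. -/
@[reducible] def profiniteTopology (G : Type*) [Group G] : TopologicalSpace G where
  IsOpen U := ∀ g ∈ U, ∃ H : Subgroup G, H.FiniteIndex ∧ ∀ h ∈ H, g * h ∈ U
  isOpen_univ := fun _ _ => ⟨⊤, inferInstance, fun _ _ => trivial⟩
  isOpen_inter := by
    intro U V hU hV g hg
    obtain ⟨H, hH, hHU⟩ := hU g hg.1
    obtain ⟨K, hK, hKV⟩ := hV g hg.2
    exact ⟨H ⊓ K, inferInstance, fun h hh => ⟨hHU h hh.1, hKV h hh.2⟩⟩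
  isOpen_sUnion := by
    intro s hs g hg
    obtain ⟨U, hU, hgU⟩ := hg
    obtain ⟨H, hH, hHU⟩ := hs U hU g hgU
    exact ⟨H, hH, fun h hh => ⟨U, hU, hHU h hh⟩⟩

end Group

section Subshifts

variable {G : Type*} [Group G]

/-- The left shift action of `G` on `2^G`: `(g · x)(h) = x (g⁻¹ h)`. -/
def shift (g : G) (x : G → Bool) : G → Bool := fun h => x (g⁻¹ * h)

/-- A word `x ∈ 2^G` is Toeplitz if it is continuous for the profinite topology on `G`
and the discrete topology on `2 = Bool`. -/
def IsToeplitzWord (x : G → Bool) : Prop :=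
  Continuous[profiniteTopology G, inferInstance] x

/-- `S ⊆ 2^G` (nonempty and compact, equivalently nonempty and closed) is a subshift if it is
invariant under the shift action. -/
def IsSubshift (S : NonemptyCompacts (G → Bool)) : Prop :=
  ∀ (g : G), ∀ x ∈ S, shift g x ∈ S

/-- A Toeplitz subshift is a subshift that is the orbit closure of a Toeplitz word. -/
def IsToeplitzSubshift (S : NonemptyCompacts (G → Bool)) : Prop :=
  IsSubshift S ∧ ∃ x : G → Bool, IsToeplitzWord x ∧
    (S : Set (G → Bool)) = closure (Set.range fun g : G => shift g x)

/-- A subshift is free if every point of it has trivial stabilizer. -/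
def IsFreeSubshift (S : NonemptyCompacts (G → Bool)) : Prop :=
  ∀ x ∈ S, ∀ g : G, g ≠ 1 → shift g x ≠ x

/-- Topological conjugacy: a `G`-equivariant homeomorphism `S → T`. -/
def Conjugate (S T : NonemptyCompacts (G → Bool)) : Prop :=
  ∃ f : S ≃ₜ T, ∀ (g : G) (x y : S),
    (y : G → Bool) = shift g (x : G → Bool) → (f y : G → Bool) = shift g (f x : G → Bool)

variable (G) in
/-- The space of nonempty closed subsets of `2^G` carries the Borel σ-algebra of the
Vietoris topology. -/
instance : MeasurableSpace (NonemptyCompacts (G → Bool)) := borel _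

variable (G) in
instance : BorelSpace (NonemptyCompacts (G → Bool)) := ⟨rfl⟩

variable (G) in
/-- The (Borel) space of free Toeplitz `G`-subshifts, as a subspace of the space of nonempty
closed subsets of `2^G`. -/
abbrev FreeToeplitzSubshift : Type _ :=
  {S : NonemptyCompacts (G → Bool) // IsToeplitzSubshift S ∧ IsFreeSubshift S}

variable (G) in
/-- The equivalence relation of topological conjugacy on free Toeplitz `G`-subshifts. -/
def conjugacy : Setoid (FreeToeplitzSubshift G) where
  r S T := Conjugate S.1 T.1
  iseqv :=
    { refl := fun S => ⟨Homeomorph.refl _, fun _ _ _ h => h⟩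
      symm := by
        rintro S T ⟨f, hf⟩
        refine ⟨f.symm, fun g x y h => ?_⟩
        have hmem := S.2.1.1 g (f.symm x : G → Bool) (f.symm x).2
        have h1 := hf g (f.symm x) ⟨_, hmem⟩ rfl
        rw [f.apply_symm_apply, ← h] at h1
        have h2 : f.symm y = ⟨_, hmem⟩ := by
          rw [← Subtype.ext h1, f.symm_apply_apply]
        rw [h2]
      trans := by
        rintro S T U ⟨f, hf⟩ ⟨f', hf'⟩
        exact ⟨f.trans f', fun g x y h => hf' g _ _ (hf g x y h)⟩ }

end Subshifts

section EquivalenceRelations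

variable {X : Type*} [MeasurableSpace X]

/-- `E` is hyperfinite: it is the union of an increasing sequence of Borel equivalence relations
with finite classes. -/
def IsHyperfinite (E : Setoid X) : Prop :=
  ∃ F : ℕ → Setoid X,
    (∀ n, MeasurableSet {p : X × X | (F n).r p.1 p.2}) ∧
    (∀ n x, {y | (F n).r x y}.Finite) ∧
    Monotone F ∧
    ∀ x y, E.r x y ↔ ∃ n, (F n).r x y

/-- `E` is `μ`-amenable: there are nonnegative Borel functions `lam n : E → ℝ` such that each
section `lam n (x, ·)` is a probability vector in `ℓ¹([x]_E)` and, for `μ`-almost every `x`,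
`‖lam n (x, ·) - lam n (y, ·)‖₁ → 0` for all `y ∈ [x]_E`. -/
def IsMuAmenable (E : Setoid X) (μ : Measure X) : Prop :=
  ∃ lam : ℕ → {p : X × X // E.r p.1 p.2} → ℝ,
    (∀ n, Measurable (lam n)) ∧
    (∀ n p, 0 ≤ lam n p) ∧
    (∀ n x, HasSum (fun z : {z // E.r x z} => lam n ⟨(x, z.1), z.2⟩) 1) ∧
    ∀ᵐ x ∂μ, ∀ (y : X) (hxy : E.r x y),
      Tendsto (fun n => ∑' z : {z // E.r x z},
        |lam n ⟨(x, z.1), z.2⟩ - lam n ⟨(y, z.1), E.trans (E.symm hxy) z.2⟩|) atTop (𝓝 0)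

end EquivalenceRelations

/-!
The idea is to exhibit a probability-measure-preserving action of `G` inside the conjugacy relation
whose stabilizers are central; an amenable relation would then give an invariant mean on `G`.

Right translation `x ↦ (h ↦ x (h g))` commutes with the left shift, so it maps every subshift to
a conjugate one. Embed `G` densely in a profinite group `K` with a chain of open normal subgroups
`N n` (`exists_profiniteChain`). A function `f : K → Bool` that is locally constant off a countable
set `D` contained in the image of `G` yields, for each `k ∈ K` outside that image, the Toeplitz word
`x_k h = f (h k)`. Its orbit closure `S_k` satisfies: `S_{gk}` is the right translate of `S_k` by `g`.
Thus the law of `S_k`, for Haar-random `k`, is invariant under right translation by `G`.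

By compactness every point of `S_k` agrees, off singularities, with `h ↦ f (κ h k)` for some
`κ ∈ K` (`ProfiniteChain.exists_of_mem_orbitClosure`). Hence both freeness of `S_k` and the
implication `S_{gk} = S_k → g ∈ center G` follow once `f` has no symmetry `f (a u b) = f u` other
than the maps `u ↦ a u b` that are the identity (`ProfiniteChain.rigidFun_rigid`). Such an `f` is
explicit: `D` consists of `1` and of representatives of the nontrivial cosets of `N (n + 1)` in
`N n`, for all `n`, and near `d ∈ D`, `d ≠ 1`, the value `f (d v)` depends only on the level of `v`, through an
oscillation pattern that is different for different `d`. Levels are invariant under conjugation,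
so a symmetry fixes every `d ≠ 1` in `D`; as these `d` accumulate at `1` and generate a dense
subgroup, it is the identity.

By the Curtis–Hedlund–Lyndon theorem every conjugacy class is enumerated by countably many Borel
maps given by block codes (`exists_enumeration_conjugacy`). With such an enumeration, hyperfiniteness
implies `μ`-amenability (`IsHyperfinite.isMuAmenable`). It also allows the probability vectors
on the classes to be pushed forward to `G`, equivariantly up to the center, by sending a point of the
class to the `G`-orbit by the first map that brings it there; the center is amenable, being abelian,
so integrating over the random `k` gives asymptotically invariant means on `G`
(`IsAmenableGroup.of_isMuAmenable`).
-/

/-! ### Amenable groups -/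

section Amenability

theorem lp_infty_abs_apply_le {ι : Type*} (f : lp (fun _ : ι => ℝ) ∞) (i : ι) : |f i| ≤ ‖f‖ :=
  lp.norm_apply_le_norm (by simp) f i

/-- A real function bounded by `C`, as an element of `ℓ^∞`. -/
def lpInftyOfBound {ι : Type*} (f : ι → ℝ) (C : ℝ) (h : ∀ i, |f i| ≤ C) :
    lp (fun _ : ι => ℝ) ∞ :=
  ⟨f, memℓp_infty ⟨C, by rintro _ ⟨i, rfl⟩; exact h i⟩⟩

@[simp]
theorem lpInftyOfBound_apply {ι : Type*} (f : ι → ℝ) (C : ℝ) (h : ∀ i, |f i| ≤ C) (i : ι) :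
    lpInftyOfBound f C h i = f i := rfl

theorem abs_mean_le {ι : Type*} (m : lp (fun _ : ι => ℝ) ∞ →ₗ[ℝ] ℝ) (h1 : m 1 = 1)
    (hpos : ∀ f : lp (fun _ : ι => ℝ) ∞, (∀ h, 0 ≤ f h) → 0 ≤ m f)
    (f : lp (fun _ : ι => ℝ) ∞) (C : ℝ) (hC : ∀ i, |f i| ≤ C) : |m f| ≤ C := by
  have h2 := hpos (C • 1 - f) fun i => by
    have := abs_le.1 (hC i)
    change 0 ≤ C * 1 - f i
    linarith
  have h3 := hpos (C • 1 + f) fun i => by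
    have := abs_le.1 (hC i)
    change 0 ≤ C * 1 + f i
    linarith
  simp only [map_sub, map_add, map_smul, h1, smul_eq_mul, mul_one] at h2 h3
  exact abs_le.2 ⟨by linarith, by linarith⟩

/-- Asymptotically invariant means have an invariant limit along an ultrafilter. -/
theorem IsAmenableGroup.of_tendsto {G : Type*} [Group G]
    (m : ℕ → lp (fun _ : G => ℝ) ∞ →ₗ[ℝ] ℝ) (h1 : ∀ n, m n 1 = 1)
    (hpos : ∀ n, ∀ f : lp (fun _ : G => ℝ) ∞, (∀ h, 0 ≤ f h) → 0 ≤ m n f)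
    (hinv : ∀ (g : G) (f f' : lp (fun _ : G => ℝ) ∞), (∀ h, f' h = f (g⁻¹ * h)) →
      Tendsto (fun n => m n f' - m n f) atTop (𝓝 0)) : IsAmenableGroup G := by
  have hlim : ∀ f, ∃ L, Tendsto (fun n => m n f) (hyperfilter ℕ : Filter ℕ) (𝓝 L) := by
    intro f
    obtain ⟨L, -, hL⟩ := (isCompact_Icc (a := -‖f‖) (b := ‖f‖)).ultrafilter_le_nhds
      ((hyperfilter ℕ).map fun n => m n f) (by
        rw [le_principal_iff]
        refine Filter.mem_map.2 (univ_mem' fun n => ?_)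
        exact abs_le.1 (abs_mean_le (m n) (h1 n) (hpos n) f _ (lp_infty_abs_apply_le f)))
    exact ⟨L, hL⟩
  choose M hM using hlim
  refine ⟨{ toFun := M, map_add' := fun f f' => ?_, map_smul' := fun c f => ?_ }, ?_, ?_, ?_⟩
  · exact tendsto_nhds_unique (hM _) (by simpa using (hM f).add (hM f'))
  · exact tendsto_nhds_unique (hM _) (by simpa using (hM f).const_mul c)
  · exact tendsto_nhds_unique (hM _) (by simp [h1])
  · exact fun f hf => ge_of_tendsto' (hM f) fun n => hpos n f hf
  · intro g f f' hff'
    have := tendsto_nhds_unique ((hM f').sub (hM f))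
      ((hinv g f f' hff').mono_left Nat.hyperfilter_le_atTop)
    exact sub_eq_zero.1 this

theorem IsAmenableGroup.of_finite (G : Type*) [Group G] [Finite G] : IsAmenableGroup G := by
  have := Fintype.ofFinite G
  have hc : (Fintype.card G : ℝ) ≠ 0 := by simp
  refine ⟨{ toFun := fun f => (∑ g, f g) / Fintype.card G, map_add' := ?_, map_smul' := ?_ },
    ?_, ?_, ?_⟩
  · intro f f'
    rw [← add_div, ← Finset.sum_add_distrib]
    rfl
  · intro c f
    simp [lp.coeFn_smul, ← Finset.mul_sum, mul_div_assoc]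
  · simp [lp.infty_coeFn_one, hc]
  · intro f hf
    exact div_nonneg (Finset.sum_nonneg fun g _ => hf g) (by positivity)
  · intro g f f' h
    simp only [LinearMap.coe_mk, AddHom.coe_mk, h]
    congr 1
    exact Fintype.sum_equiv (Equiv.mulLeft g⁻¹) _ _ fun _ => rfl

section Abelian

variable {Z : Type*} [CommGroup Z]

/-- The average of a function over its translates by `1, e, …, e ^ n`. -/
noncomputable def powAverage (n : ℕ) (e : Z) : (Z → ℝ) →ₗ[ℝ] (Z → ℝ) where
  toFun f z := (∑ s ∈ Finset.range (n + 1), f (e ^ s * z)) / (n + 1)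
  map_add' f f' := by
    ext z; simp [Finset.sum_add_distrib, add_div]
  map_smul' c f := by
    ext z; simp [← Finset.mul_sum, mul_div_assoc]

theorem powAverage_apply (n : ℕ) (e : Z) (f : Z → ℝ) (z : Z) :
    powAverage n e f z = (∑ s ∈ Finset.range (n + 1), f (e ^ s * z)) / (n + 1) := rfl

/-- The average of a function over its translates by `∏ j < k, e j ^ s j` with all `s j ≤ n`. -/
noncomputable def iterPowAverage (n : ℕ) (e : ℕ → Z) : ℕ → (Z → ℝ) →ₗ[ℝ] (Z → ℝ)
  | 0 => LinearMap.id
  | k + 1 => powAverage n (e k) ∘ₗ iterPowAverage n e k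

theorem powAverage_abs_le {n : ℕ} {e : Z} {f : Z → ℝ} {C : ℝ} (hf : ∀ z, |f z| ≤ C) (z : Z) :
    |powAverage n e f z| ≤ C := by
  have hn : (0 : ℝ) < n + 1 := by positivity
  rw [powAverage_apply, abs_div, abs_of_pos hn, div_le_iff₀ hn]
  refine (Finset.abs_sum_le_sum_abs _ _).trans ((Finset.sum_le_sum fun s _ => hf _).trans ?_)
  simp [mul_comm]

theorem iterPowAverage_abs_le {n : ℕ} {e : ℕ → Z} {f : Z → ℝ} {C : ℝ} (hf : ∀ z, |f z| ≤ C)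
    (k : ℕ) : ∀ z, |iterPowAverage n e k f z| ≤ C := by
  induction k with
  | zero => exact hf
  | succ k ih => exact powAverage_abs_le ih

theorem iterPowAverage_nonneg {n : ℕ} {e : ℕ → Z} {f : Z → ℝ} (hf : ∀ z, 0 ≤ f z)
    (k : ℕ) : ∀ z, 0 ≤ iterPowAverage n e k f z := by
  induction k with
  | zero => exact hf
  | succ k ih =>
    exact fun z => div_nonneg (Finset.sum_nonneg fun s _ => ih _) (by positivity)

theorem iterPowAverage_one {n : ℕ} {e : ℕ → Z} (k : ℕ) : iterPowAverage n e k 1 = 1 := by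
  induction k with
  | zero => rfl
  | succ k ih =>
    have hn : (n : ℝ) + 1 ≠ 0 := by positivity
    ext z
    simp [iterPowAverage, ih, powAverage_apply, hn]

theorem iterPowAverage_translate {n : ℕ} {e : ℕ → Z} (a : Z) (f : Z → ℝ) (k : ℕ) :
    iterPowAverage n e k (fun z => f (a * z)) = fun z => iterPowAverage n e k f (a * z) := by
  induction k with
  | zero => rfl
  | succ k ih =>
    ext z
    simp [iterPowAverage, ih, powAverage_apply, mul_left_comm]

theorem powAverage_sub_translate {n : ℕ} {e : Z} {f : Z → ℝ} {C : ℝ} (hf : ∀ z, |f z| ≤ C)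
    (z : Z) : |powAverage n e (fun z => f (e⁻¹ * z)) z - powAverage n e f z| ≤ 2 * C / (n + 1) := by
  have hn : (0 : ℝ) < n + 1 := by positivity
  have key : (∑ s ∈ Finset.range (n + 1), f (e⁻¹ * (e ^ s * z)))
      - (∑ s ∈ Finset.range (n + 1), f (e ^ s * z)) = f (e⁻¹ * z) - f (e ^ n * z) := by
    rw [Finset.sum_range_succ', Finset.sum_range_succ (fun s => f (e ^ s * z))]
    simp only [pow_succ', mul_assoc, inv_mul_cancel_left, pow_zero, one_mul]
    ring
  rw [powAverage_apply, powAverage_apply, ← sub_div, key, abs_div, abs_of_pos hn]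
  gcongr
  refine (abs_sub _ _).trans ?_
  linarith [hf (e⁻¹ * z), hf (e ^ n * z)]

theorem iterPowAverage_sub_translate {n : ℕ} {e : ℕ → Z} {f : Z → ℝ} {C : ℝ}
    (hf : ∀ z, |f z| ≤ C) {i k : ℕ} (hik : i < k) :
    ∀ z, |iterPowAverage n e k ((fun z => f ((e i)⁻¹ * z)) - f) z| ≤ 2 * C / (n + 1) := by
  induction k with
  | zero => omega
  | succ k ih =>
    rcases Nat.lt_succ_iff_lt_or_eq.1 hik with h | rfl
    · exact powAverage_abs_le (ih h)
    · intro z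
      rw [map_sub]
      simp only [iterPowAverage, LinearMap.comp_apply, iterPowAverage_translate, Pi.sub_apply]
      exact powAverage_sub_translate (iterPowAverage_abs_le hf i) z

/-- Countable abelian groups are amenable: averaging over larger and larger boxes
`∏ j < n, e j ^ s j`, `s j ≤ n`, is asymptotically invariant. -/
theorem IsAmenableGroup.of_comm [Countable Z] : IsAmenableGroup Z := by
  obtain ⟨e, he⟩ := exists_surjective_nat Z
  refine IsAmenableGroup.of_tendsto
    (fun n => { toFun := fun f => iterPowAverage n e n f 1, map_add' := ?_, map_smul' := ?_ })
    ?_ ?_ ?_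
  · intro f f'
    exact congrFun (map_add (iterPowAverage n e n) (f : Z → ℝ) (f' : Z → ℝ)) 1
  · intro c f
    simp [lp.coeFn_smul]
  · intro n
    exact congrFun (iterPowAverage_one (n := n) (e := e) n) 1
  · exact fun n f hf => iterPowAverage_nonneg hf n 1
  · intro g f f' hff'
    obtain ⟨i, rfl⟩ := he g
    have h0 : Tendsto (fun n : ℕ => 2 * ‖f‖ / ((n : ℝ) + 1)) atTop (𝓝 0) :=
      tendsto_const_nhds.div_atTop (tendsto_natCast_atTop_atTop.atTop_add tendsto_const_nhds)
    refine squeeze_zero_norm' ?_ h0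
    filter_upwards [eventually_gt_atTop i] with n hn
    have hf' : (f' : Z → ℝ) = fun z => f ((e i)⁻¹ * z) := funext hff'
    have := iterPowAverage_sub_translate (n := n) (e := e) (lp_infty_abs_apply_le f) hn 1
    rw [map_sub, Pi.sub_apply] at this
    rw [← hf'] at this
    exact this

end Abelian

end Amenability

/-! ### Sums over countable equivalence classes -/

section Enumeration

variable {X : Type*}

/-- `i` is the least index at which the enumeration `ψ · x` takes the value `ψ i x`. -/
def IsFirstIndex (ψ : ℕ → X → X) (x : X) (i : ℕ) : Prop := ∀ j < i, ψ j x ≠ ψ i x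

open Classical in
theorem hasSum_iff_hasSum_firstIndex (ψ : ℕ → X → X) (x : X) (w : X → ℝ)
    (hw : ∀ z, (∀ i, ψ i x ≠ z) → w z = 0) (a : ℝ) :
    HasSum w a ↔ HasSum (fun i => if IsFirstIndex ψ x i then w (ψ i x) else 0) a := by
  have hinj : Function.Injective fun i : {i // IsFirstIndex ψ x i} => ψ i x := by
    rintro ⟨i, hi⟩ ⟨j, hj⟩ hij
    rcases lt_trichotomy i j with h | h | h
    · exact (hj i h hij).elim
    · exact Subtype.ext h
    · exact (hi j h hij.symm).elim
  rw [← hinj.hasSum_iff]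
  · change HasSum ((fun i => w (ψ i x)) ∘ ((↑) : {i | IsFirstIndex ψ x i} → ℕ)) a ↔ _
    rw [hasSum_subtype_iff_indicator]
    rfl
  · intro z hz
    refine hw z fun i hi => hz ?_
    have hex : ∃ i, ψ i x = z := ⟨i, hi⟩
    refine ⟨⟨Nat.find hex, fun j hj h => ?_⟩, Nat.find_spec hex⟩
    exact Nat.find_min hex hj (h.trans (Nat.find_spec hex))

variable [MeasurableSpace X]

theorem measurableSet_isFirstIndex [MeasurableEq X] {ψ : ℕ → X → X} (hψ : ∀ i, Measurable (ψ i))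
    (i : ℕ) : MeasurableSet {x | IsFirstIndex ψ x i} := by
  simp only [IsFirstIndex, Set.ofPred_forall]
  exact MeasurableSet.iInter fun j => MeasurableSet.iInter fun _ =>
    (measurableSet_eq_fun (hψ j) (hψ i)).compl

theorem measurable_tsum_real {Ω : Type*} [MeasurableSpace Ω] {F : ℕ → Ω → ℝ}
    (hF : ∀ i, Measurable (F i)) (hs : ∀ ω, Summable fun i => F i ω) :
    Measurable fun ω => ∑' i, F i ω :=
  measurable_of_tendsto_metrizable (f := fun n ω => ∑ i ∈ Finset.range n, F i ω)
    (fun _ => Finset.measurable_fun_sum _ fun i _ => hF i)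
    (tendsto_pi_nhds.2 fun ω => (hs ω).hasSum.tendsto_sum_nat)

/-- Sums over equivalence classes depend measurably on the class, since the classes are
enumerated by the measurable maps `ψ i`. -/
theorem measurable_tsum_of_enumeration [MeasurableEq X] {Ω : Type*} [MeasurableSpace Ω]
    {ψ : ℕ → X → X} (hψ : ∀ i, Measurable (ψ i)) {Φ : Ω → X} (hΦ : Measurable Φ)
    {w : Ω → X → ℝ} (hw : ∀ ω z, (∀ i, ψ i (Φ ω) ≠ z) → w ω z = 0)
    (hs : ∀ ω, Summable (w ω)) (hm : ∀ i, Measurable fun ω => w ω (ψ i (Φ ω))) :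
    Measurable fun ω => ∑' z, w ω z := by
  classical
  have key : ∀ ω, HasSum (fun i => if IsFirstIndex ψ (Φ ω) i then w ω (ψ i (Φ ω)) else 0)
      (∑' z, w ω z) := fun ω =>
    (hasSum_iff_hasSum_firstIndex ψ (Φ ω) (w ω) (hw ω) _).1 (hs ω).hasSum
  have := measurable_tsum_real
    (F := fun i ω => if IsFirstIndex ψ (Φ ω) i then w ω (ψ i (Φ ω)) else 0)
    (fun i => Measurable.ite (hΦ (measurableSet_isFirstIndex hψ i)) (hm i) measurable_const)
    (fun ω => (key ω).summable)
  convert this using 2 with ω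
  exact (key ω).tsum_eq.symm

end Enumeration

/-! ### Hyperfinite and amenable relations -/

section Amenable

variable {X : Type*} [MeasurableSpace X]

/-- The functions `lam n`, extended by zero from `E` to `X × X`. -/
theorem IsMuAmenable.exists_extension {E : Setoid X} {μ : Measure X} (h : IsMuAmenable E μ) :
    ∃ L : ℕ → X → X → ℝ,
      (∀ n, Measurable fun p : {p : X × X // E.r p.1 p.2} => L n p.1.1 p.1.2) ∧
      (∀ n x z, 0 ≤ L n x z) ∧ (∀ n x z, ¬ E.r x z → L n x z = 0) ∧
      (∀ n x, HasSum (L n x) 1) ∧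
      ∀ᵐ x ∂μ, ∀ y, E.r x y → Tendsto (fun n => ∑' z, |L n x z - L n y z|) atTop (𝓝 0) := by
  classical
  obtain ⟨lam, hm, h0, h1, hlim⟩ := h
  have hL : ∀ n x (z : {z // E.r x z}),
      (if h : E.r x z.1 then lam n ⟨(x, z.1), h⟩ else 0) = lam n ⟨(x, z.1), z.2⟩ :=
    fun n x z => dif_pos z.2
  refine ⟨fun n x z => if h : E.r x z then lam n ⟨(x, z), h⟩ else 0, fun n => ?_,
    fun n x z => ?_, fun n x z hxz => dif_neg hxz, fun n x => ?_, ?_⟩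
  · convert hm n using 2 with p
    exact dif_pos p.2
  · dsimp only
    split_ifs
    exacts [h0 _ _, le_rfl]
  · rw [← Subtype.val_injective.hasSum_iff (f := fun z : X => _)
      (g := fun z : {z // E.r x z} => z.1)]
    · convert h1 n x using 2 with z
      exact hL n x z
    · rintro z hz
      exact dif_neg fun h => hz ⟨⟨z, h⟩, rfl⟩
  · filter_upwards [hlim] with x hx y hxy
    convert hx y hxy using 2 with n
    rw [← Subtype.val_injective.tsum_eq (g := fun z : {z // E.r x z} => z.1)]
    · refine tsum_congr fun z => ?_
      rw [hL n x z, dif_pos (E.trans (E.symm hxy) z.2)]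
    · intro z hz
      by_contra hne
      have h1 : ¬ E.r x z := fun h => hne ⟨⟨z, h⟩, rfl⟩
      have h2 : ¬ E.r y z := fun h => h1 (E.trans hxy h)
      simp [h1, h2] at hz

/-- A hyperfinite relation whose classes are enumerated by countably many measurable maps is
amenable: `lam n (x, ·)` is the uniform distribution on the class of `x` for `F n`. -/
theorem IsHyperfinite.isMuAmenable [MeasurableEq X] {E : Setoid X} {ψ : ℕ → X → X}
    (hψ : ∀ i, Measurable (ψ i)) (hE : ∀ x y, E.r x y ↔ ∃ i, ψ i x = y) (h : IsHyperfinite E)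
    (μ : Measure X) : IsMuAmenable E μ := by
  classical
  obtain ⟨F, hFm, hFfin, hmono, hF⟩ := h
  have hsub : ∀ {n x y}, (F n).r x y → E.r x y := fun h => (hF _ _).2 ⟨_, h⟩
  have hind : ∀ n x (c : ℝ), HasSum (fun z => if (F n).r x z then c else 0)
      ({y | (F n).r x y}.ncard * c) := by
    intro n x c
    have := hasSum_sum_of_ne_finset_zero (L := .unconditional X)
      (f := fun z => if (F n).r x z then c else 0)
      (s := (hFfin n x).toFinset) (by
        intro z hz
        exact if_neg (by simpa using hz))
    rw [Finset.sum_congr rfl (g := fun _ => c) (by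
      intro z hz
      exact if_pos (by simpa using hz))] at this
    rwa [Finset.sum_const, nsmul_eq_mul, ← Set.ncard_eq_toFinset_card _ (hFfin n x)] at this
  have hcard : ∀ n x, ({y | (F n).r x y}.ncard : ℝ) ≠ 0 := by
    intro n x
    rw [Nat.cast_ne_zero]
    exact (Set.ncard_pos (hFfin n x)).2 ⟨x, (F n).refl x⟩ |>.ne'
  have hcardm : ∀ n, Measurable fun x => ({y | (F n).r x y}.ncard : ℝ) := by
    intro n
    have := measurable_tsum_of_enumeration hψ measurable_id
      (w := fun x z => if (F n).r x z then (1 : ℝ) else 0)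
      (fun x z hz => if_neg fun h => by
        obtain ⟨i, hi⟩ := (hE x z).1 (hsub h)
        exact hz i hi)
      (fun x => (hind n x 1).summable)
      (fun i => Measurable.ite ((measurable_id.prodMk (hψ i)) (hFm n)) measurable_const
        measurable_const)
    convert this using 2 with x
    rw [(hind n x 1).tsum_eq, mul_one]
  refine ⟨fun n p => if (F n).r p.1.1 p.1.2 then ({y | (F n).r p.1.1 y}.ncard : ℝ)⁻¹ else 0,
    fun n => ?_, fun n p => ?_, fun n x => ?_, ?_⟩
  · exact Measurable.ite (measurable_subtype_coe (hFm n))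
      ((hcardm n).comp (measurable_fst.comp measurable_subtype_coe)).inv measurable_const
  · dsimp only
    split_ifs <;> positivity
  · have := hind n x ({y | (F n).r x y}.ncard : ℝ)⁻¹
    rw [mul_inv_cancel₀ (hcard n x)] at this
    rw [← Subtype.val_injective.hasSum_iff (g := fun z : {z // E.r x z} => z.1)] at this
    · exact this
    · rintro z hz
      exact if_neg fun h => hz ⟨⟨z, hsub h⟩, rfl⟩
  · refine Eventually.of_forall fun x y hxy => ?_
    obtain ⟨N, hN⟩ := (hF x y).1 hxy
    refine tendsto_const_nhds.congr' ?_
    filter_upwards [eventually_ge_atTop N] with n hn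
    have hxy' : (F n).r x y := hmono hn hN
    have hiff : ∀ z, (F n).r x z ↔ (F n).r y z :=
      fun z => ⟨(F n).trans ((F n).symm hxy'), (F n).trans hxy'⟩
    simp [hiff]

end Amenable

/-! ### From amenable relations to amenable groups -/

section Mean

variable {G : Type*} [Group G]

/-- The function `g ↦ m (z ↦ f (g z))` on `G`, for a mean `m` on a subgroup `Z`. If `m` is
invariant, this function is invariant under right translation by `Z`. -/
noncomputable def cosetMean {Z : Subgroup G} (m : lp (fun _ : Z => ℝ) ∞ →ₗ[ℝ] ℝ)
    (f : lp (fun _ : G => ℝ) ∞) (g : G) : ℝ :=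
  m (lpInftyOfBound (fun z : Z => f (g * z)) ‖f‖ fun _ => lp_infty_abs_apply_le f _)

/-- The least `i` for which `ψ i z` lies in the image under `Φ` of the orbit of `ω`. -/
noncomputable def returnIndex (G : Type*) [Group G] {X Ω : Type*} [MulAction G Ω] (ψ : ℕ → X → X)
    (Φ : Ω → X) (ω : Ω) (z : X) : ℕ :=
  sInf {i | ∃ g : G, ψ i z = Φ (g • ω)}

open Classical in
/-- An element `r` of `G` such that the first of the points `ψ i z` that lies in the image under
`Φ` of the orbit of `ω` is `Φ (r⁻¹ • ω)`. The choice of that point depends only on `z` and the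
orbit, whence `r (g • ω) z = g * r ω z` up to stabilizers. -/
noncomputable def returnElt (G : Type*) [Group G] {X Ω : Type*} [MulAction G Ω] (ψ : ℕ → X → X)
    (Φ : Ω → X) (ω : Ω) (z : X) : G :=
  if h : ∃ g : G, ψ (returnIndex G ψ Φ ω z) z = Φ (g⁻¹ • ω) then h.choose else 1

variable {X Ω : Type*} [MulAction G Ω] {ψ : ℕ → X → X} {Φ : Ω → X}

theorem returnIndex_smul (g : G) (ω : Ω) (z : X) :
    returnIndex G ψ Φ (g • ω) z = returnIndex G ψ Φ ω z := by
  unfold returnIndex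
  congr 1
  ext i
  constructor
  · rintro ⟨h, hh⟩
    exact ⟨h * g, by rw [hh, mul_smul]⟩
  · rintro ⟨h, hh⟩
    exact ⟨h * g⁻¹, by rw [hh, mul_smul, inv_smul_smul]⟩

theorem returnElt_spec {ω : Ω} {z : X} (h : ∃ i, ψ i z = Φ ω) :
    ψ (returnIndex G ψ Φ ω z) z = Φ ((returnElt G ψ Φ ω z)⁻¹ • ω) := by
  have h1 : ∃ g : G, ψ (returnIndex G ψ Φ ω z) z = Φ (g • ω) := by
    obtain ⟨i, hi⟩ := h
    exact Nat.sInf_mem (s := {i | ∃ g : G, ψ i z = Φ (g • ω)}) ⟨i, 1, by rw [hi, one_smul]⟩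
  have h2 : ∃ g : G, ψ (returnIndex G ψ Φ ω z) z = Φ (g⁻¹ • ω) := by
    obtain ⟨g, hg⟩ := h1
    exact ⟨g⁻¹, by rwa [inv_inv]⟩
  rw [returnElt, dif_pos h2]
  exact h2.choose_spec

theorem mul_inv_mem_of_map_smul_eq {Z : Subgroup G}
    (hstab : ∀ (g : G) ω, Φ (g • ω) = Φ ω → g ∈ Z) {g h : G} {ω : Ω}
    (hgh : Φ (g • ω) = Φ (h • ω)) : g * h⁻¹ ∈ Z :=
  hstab _ (h • ω) (by rw [mul_smul, inv_smul_smul, hgh])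

theorem apply_returnElt_smul {Z : Subgroup G}
    (hstab : ∀ (g : G) ω, Φ (g • ω) = Φ ω → g ∈ Z) {φ : G → ℝ}
    (hφ : ∀ g, ∀ z ∈ Z, φ (g * z) = φ g) (g : G) {ω : Ω} {z : X} (h : ∃ i, ψ i z = Φ ω)
    (h' : ∃ i, ψ i z = Φ (g • ω)) :
    φ (returnElt G ψ Φ (g • ω) z) = φ (g * returnElt G ψ Φ ω z) := by
  have h1 := returnElt_spec (G := G) h
  have h2 := returnElt_spec (G := G) h'
  rw [returnIndex_smul, h1, ← mul_smul] at h2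
  have := mul_inv_mem_of_map_smul_eq hstab h2
  rw [← hφ (g * returnElt G ψ Φ ω z) _ this]
  congr 1
  group

theorem measurable_apply_returnElt [Countable G] [MeasurableSpace X] [MeasurableEq X]
    [MeasurableSpace Ω] {Z : Subgroup G}
    (hstab : ∀ (g : G) ω, Φ (g • ω) = Φ ω → g ∈ Z) {φ : G → ℝ}
    (hφ : ∀ g, ∀ z ∈ Z, φ (g * z) = φ g) (hψ : ∀ i, Measurable (ψ i)) (hΦ : Measurable Φ)
    (hsmul : ∀ g : G, Measurable fun ω : Ω => g • ω) {θ : Ω → X} (hθ : Measurable θ)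
    (h : ∀ ω, ∃ i, ψ i (θ ω) = Φ ω) :
    Measurable fun ω => φ (returnElt G ψ Φ ω (θ ω)) := by
  have hA : ∀ (j : ℕ) (g : G), MeasurableSet {ω | ψ j (θ ω) = Φ (g • ω)} := fun j g =>
    measurableSet_eq_fun ((hψ j).comp hθ) (hΦ.comp (hsmul g))
  -- The function is constant on each of the sets `A (j, g)`, which cover `Ω`.
  let A : ℕ × G → Set Ω := fun p => {ω | ψ p.1 (θ ω) = Φ (p.2 • ω)} ∩
    ⋂ j, ⋂ (_ : j < p.1), ⋂ g' : G, {ω | ψ j (θ ω) = Φ (g' • ω)}ᶜ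
  have hAm : ∀ p, MeasurableSet (A p) := fun p => (hA _ _).inter <|
    MeasurableSet.iInter fun j => MeasurableSet.iInter fun _ => MeasurableSet.iInter fun g' =>
      (hA j g').compl
  have hidx : ∀ p, ∀ ω ∈ A p, returnIndex G ψ Φ ω (θ ω) = p.1 := by
    rintro ⟨j, g⟩ ω ⟨h1, h2⟩
    refine le_antisymm (Nat.sInf_le ⟨g, h1⟩) ?_
    refine le_csInf ⟨j, g, h1⟩ ?_
    rintro i ⟨g', hi⟩
    by_contra hij
    simp only [Set.mem_iInter] at h2
    exact h2 i (not_le.1 hij) g' hi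
  have hval : ∀ p, ∀ ω ∈ A p, φ (returnElt G ψ Φ ω (θ ω)) = φ p.2⁻¹ := by
    rintro ⟨j, g⟩ ω hω
    have h1 := returnElt_spec (G := G) (h ω)
    rw [hidx _ ω hω, hω.1] at h1
    have := mul_inv_mem_of_map_smul_eq hstab h1
    rw [← hφ g⁻¹ _ this, inv_inv, inv_mul_cancel_left]
  intro B hB
  have : (fun ω => φ (returnElt G ψ Φ ω (θ ω))) ⁻¹' B
      = ⋃ p : {p : ℕ × G // φ p.2⁻¹ ∈ B}, A p.1 := by
    ext ω
    simp only [Set.mem_preimage, Set.mem_iUnion]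
    constructor
    · intro hω
      obtain ⟨i, hi⟩ := h ω
      have hne : {i | ∃ g : G, ψ i (θ ω) = Φ (g • ω)}.Nonempty := ⟨i, 1, by rw [hi, one_smul]⟩
      obtain ⟨g, hg⟩ := Nat.sInf_mem hne
      have hmem : ω ∈ A (sInf {i | ∃ g : G, ψ i (θ ω) = Φ (g • ω)}, g) := by
        refine ⟨hg, ?_⟩
        simp only [Set.mem_iInter]
        exact fun j hj g' hg' => Nat.notMem_of_lt_sInf hj ⟨g', hg'⟩
      exact ⟨⟨_, by rwa [← hval _ _ hmem]⟩, hmem⟩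
    · rintro ⟨⟨p, hp⟩, hω⟩
      rwa [hval p ω hω]
  rw [this]
  exact MeasurableSet.iUnion fun p => hAm _

end Mean

/-- Suppose `G` acts on a probability space `Ω` preserving the measure and `Φ : Ω → X` maps orbits
into `E`-classes with stabilizers contained in an amenable subgroup. If `E` is amenable for
the image measure, then `G` is amenable: push the probability vectors `lam n (Φ ω, ·)` to `G` by
`returnElt`, evaluate a function on `G`, averaged over the cosets of `Z`, and integrate over `Ω`. -/
theorem IsAmenableGroup.of_isMuAmenable {G : Type*} [Group G] [Countable G] {Z : Subgroup G}
    (hZ : IsAmenableGroup Z) {X : Type*} [MeasurableSpace X] [MeasurableEq X] {E : Setoid X}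
    {ψ : ℕ → X → X} (hψ : ∀ i, Measurable (ψ i)) (hE : ∀ x y, E.r x y ↔ ∃ i, ψ i x = y)
    {Ω : Type*} [MeasurableSpace Ω] {ν : Measure Ω} [IsProbabilityMeasure ν] [MulAction G Ω]
    (hν : ∀ g : G, MeasurePreserving (fun ω : Ω => g • ω) ν ν)
    {Φ : Ω → X} (hΦ : Measurable Φ) (horb : ∀ (g : G) ω, E.r (Φ ω) (Φ (g • ω)))
    (hstab : ∀ (g : G) ω, Φ (g • ω) = Φ ω → g ∈ Z) (h : IsMuAmenable E (ν.map Φ)) :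
    IsAmenableGroup G := by
  obtain ⟨mZ, hZ1, hZpos, hZinv⟩ := hZ
  obtain ⟨L, hLm, hL0, hLE, hL1, hLlim⟩ := h.exists_extension
  have hbd : ∀ f g, |cosetMean mZ f g| ≤ ‖f‖ := fun f g =>
    abs_mean_le mZ hZ1 hZpos _ _ fun i => lp_infty_abs_apply_le f _
  have hright : ∀ f g, ∀ z ∈ Z, cosetMean mZ f (g * z) = cosetMean mZ f g := by
    intro f g z hz
    refine hZinv ⟨z, hz⟩⁻¹ _ _ fun z' => ?_
    simp [mul_assoc]
  let r : Ω → X → G := returnElt G ψ Φ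
  have hex : ∀ ω z, E.r (Φ ω) z → ∃ i, ψ i z = Φ ω := fun ω z hz => (hE _ _).1 (E.symm hz)
  -- The evaluation of a function at the push-forward of `L n (Φ ω, ·)` to `G`.
  let P : ℕ → (G → ℝ) → Ω → ℝ := fun n φ ω => ∑' z, L n (Φ ω) z * φ (r ω z)
  have hle : ∀ {φ : G → ℝ} {C : ℝ}, (∀ g, |φ g| ≤ C) → ∀ n ω z,
      ‖L n (Φ ω) z * φ (r ω z)‖ ≤ L n (Φ ω) z * C := by
    intro φ C hC n ω z
    rw [Real.norm_eq_abs, abs_mul, abs_of_nonneg (hL0 _ _ _)]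
    exact mul_le_mul_of_nonneg_left (hC _) (hL0 _ _ _)
  have hPs : ∀ {φ : G → ℝ} {C : ℝ}, (∀ g, |φ g| ≤ C) → ∀ n ω,
      Summable fun z => L n (Φ ω) z * φ (r ω z) := by
    intro φ C hC n ω
    exact Summable.of_norm_bounded ((hL1 n (Φ ω)).summable.mul_right C) (hle hC n ω)
  have hPb : ∀ {φ : G → ℝ} {C : ℝ}, (∀ g, |φ g| ≤ C) → ∀ n ω, ‖P n φ ω‖ ≤ C := by
    intro φ C hC n ω
    have := tsum_of_norm_bounded ((hL1 n (Φ ω)).mul_right C) (hle hC n ω)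
    rwa [one_mul] at this
  have hPm : ∀ (f) n, Measurable (P n (cosetMean mZ f)) := by
    intro f n
    refine measurable_tsum_of_enumeration hψ hΦ ?_ (hPs (hbd f) n) fun i => ?_
    · intro ω z hz
      rw [hLE, zero_mul]
      intro hEz
      obtain ⟨i, hi⟩ := (hE _ _).1 hEz
      exact hz i hi
    · have hEi : ∀ ω, E.r (Φ ω) (ψ i (Φ ω)) := fun ω => (hE _ _).2 ⟨i, rfl⟩
      refine Measurable.mul ?_ ?_
      · exact (hLm n).comp
          (Measurable.subtype_mk (hΦ.prodMk ((hψ i).comp hΦ)) (h := fun ω => hEi ω))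
      · exact measurable_apply_returnElt hstab (hright f) hψ hΦ (fun g => (hν g).measurable)
          ((hψ i).comp hΦ) fun ω => hex _ _ (hEi ω)
  have hPi : ∀ f n, Integrable (P n (cosetMean mZ f)) ν := fun f n =>
    Integrable.of_bound (hPm f n).aestronglyMeasurable ‖f‖
      (Eventually.of_forall fun ω => hPb (hbd f) n ω)
  refine IsAmenableGroup.of_tendsto
    (fun n => { toFun := fun f => ∫ ω, P n (cosetMean mZ f) ω ∂ν, map_add' := ?_, map_smul' := ?_ })
    ?_ ?_ ?_
  · intro f f'
    rw [← integral_add (hPi f n) (hPi f' n)]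
    congr 1
    ext ω
    simp only [P]
    rw [← (hPs (hbd f) n ω).tsum_add (hPs (hbd f') n ω)]
    refine tsum_congr fun z => ?_
    rw [← mul_add]
    congr 1
    simp only [cosetMean]
    rw [← map_add]
    rfl
  · intro c f
    rw [RingHom.id_apply, smul_eq_mul, ← integral_const_mul]
    congr 1
    ext ω
    simp only [P]
    rw [← tsum_mul_left]
    refine tsum_congr fun z => ?_
    rw [mul_left_comm]
    congr 1
    simp only [cosetMean]
    rw [← smul_eq_mul, ← map_smul]
    rfl
  · intro n
    have h1 : ∀ g, cosetMean mZ 1 g = 1 := fun g => hZ1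
    simp [P, h1, (hL1 n _).tsum_eq]
  · intro n f hf
    exact integral_nonneg fun ω => tsum_nonneg fun z =>
      mul_nonneg (hL0 _ _ _) (hZpos _ fun z' => hf _)
  · intro g f f' hff'
    have hcos : ∀ k, cosetMean mZ f' k = cosetMean mZ f (g⁻¹ * k) := by
      intro k
      simp only [cosetMean]
      congr 1
      ext z
      simp [hff', mul_assoc]
    have hshift : ∀ n, ∫ ω, P n (cosetMean mZ f) ω ∂ν
        = ∫ ω, P n (cosetMean mZ f) (g⁻¹ • ω) ∂ν := by
      intro n
      rw [← integral_map (φ := fun ω : Ω => g⁻¹ • ω) (hν g⁻¹).measurable.aemeasurable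
        (hPm f n).aestronglyMeasurable, (hν g⁻¹).map_eq]
    have hPi' : ∀ n, Integrable (fun ω => P n (cosetMean mZ f) (g⁻¹ • ω)) ν := fun n =>
      (hν g⁻¹).integrable_comp_of_integrable (hPi f n)
    have hdiff : ∀ n, (∫ ω, P n (cosetMean mZ f') ω ∂ν) - ∫ ω, P n (cosetMean mZ f) ω ∂ν
        = ∫ ω, (P n (cosetMean mZ f') ω - P n (cosetMean mZ f) (g⁻¹ • ω)) ∂ν := by
      intro n
      rw [hshift, integral_sub (hPi f' n) (hPi' n)]
    -- By equivariance of `r`, translating `f` amounts to replacing `ω` by `g⁻¹ • ω` in `r`, so that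
    -- only the difference of the two probability vectors on the common class remains.
    have hpt : ∀ n ω, ‖P n (cosetMean mZ f') ω - P n (cosetMean mZ f) (g⁻¹ • ω)‖
        ≤ ‖f‖ * ∑' z, |L n (Φ ω) z - L n (Φ (g⁻¹ • ω)) z| := by
      intro n ω
      have hs : Summable fun z => |L n (Φ ω) z - L n (Φ (g⁻¹ • ω)) z| :=
        ((hL1 n _).summable.sub (hL1 n _).summable).abs
      have hrw : ∀ z, L n (Φ (g⁻¹ • ω)) z * cosetMean mZ f (r (g⁻¹ • ω) z)
          = L n (Φ (g⁻¹ • ω)) z * cosetMean mZ f' (r ω z) := by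
        intro z
        by_cases hz : E.r (Φ (g⁻¹ • ω)) z
        · rw [hcos, apply_returnElt_smul hstab (hright f) g⁻¹
            (hex _ _ (E.trans (horb g⁻¹ ω) hz)) (hex _ _ hz)]
        · rw [hLE _ _ _ hz, zero_mul, zero_mul]
      have hbd' : ∀ k, |cosetMean mZ f' k| ≤ ‖f‖ := fun k => by rw [hcos]; exact hbd f _
      have h2 : Summable fun z => L n (Φ (g⁻¹ • ω)) z * cosetMean mZ f' (r ω z) := by
        simpa only [hrw] using hPs (hbd f) n (g⁻¹ • ω)
      have heq : P n (cosetMean mZ f') ω - P n (cosetMean mZ f) (g⁻¹ • ω)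
          = ∑' z, (L n (Φ ω) z - L n (Φ (g⁻¹ • ω)) z) * cosetMean mZ f' (r ω z) := by
        simp only [P, hrw]
        rw [← (hPs hbd' n ω).tsum_sub h2]
        exact tsum_congr fun z => by ring
      rw [heq, mul_comm]
      refine tsum_of_norm_bounded (hs.hasSum.mul_right ‖f‖) fun z => ?_
      rw [norm_mul]
      exact mul_le_mul_of_nonneg_left (hbd' _) (norm_nonneg _)
    have hlim : ∀ᵐ ω ∂ν, Tendsto
        (fun n => P n (cosetMean mZ f') ω - P n (cosetMean mZ f) (g⁻¹ • ω)) atTop (𝓝 0) := by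
      filter_upwards [ae_of_ae_map hΦ.aemeasurable hLlim] with ω hω
      refine squeeze_zero_norm (hpt · ω) ?_
      simpa using (hω _ (horb g⁻¹ ω)).const_mul ‖f‖
    have := tendsto_integral_of_dominated_convergence (μ := ν) (fun _ => ‖f'‖ + ‖f‖)
      (fun n => ((hPi f' n).sub (hPi' n)).aestronglyMeasurable) (integrable_const _)
      (fun n => Eventually.of_forall fun ω =>
        (norm_sub_le _ _).trans (add_le_add (hPb (hbd f') n ω) (hPb (hbd f) n (g⁻¹ • ω)))) hlim
    rw [integral_zero] at this
    exact this.congr fun n => (hdiff n).symm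

/-! ### Block codes between subshifts -/

section BlockCodes

variable {G : Type*} [Group G]

theorem shift_shift (g h : G) (x : G → Bool) : shift g (shift h x) = shift (g * h) x := by
  ext k
  simp [shift, mul_assoc]

theorem shift_one (x : G → Bool) : shift 1 x = x := by
  ext k
  simp [shift]

theorem continuous_shift (g : G) : Continuous (shift g : (G → Bool) → G → Bool) :=
  continuous_pi fun _ => continuous_apply _

theorem continuous_mul_right_profinite (t : G) :
    Continuous[profiniteTopology G, profiniteTopology G] fun h : G => h * t := by
  let := profiniteTopology G
  rw [continuous_def]
  intro U hU g hg
  obtain ⟨H, hH, hHU⟩ := hU (g * t) hg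
  refine ⟨H.comap (MulAut.conj t⁻¹).toMonoidHom, ?_, fun h hh => ?_⟩
  · rw [Subgroup.finiteIndex_iff,
      Subgroup.index_comap_of_surjective (f := (MulAut.conj t⁻¹).toMonoidHom) H
        (MulAut.conj t⁻¹).surjective]
    exact hH.index_ne_zero
  · have := hHU _ hh
    simpa [mul_assoc] using this

/-- If `φ` is a continuous equivariant map of `2^G` that preserves Toeplitz words and is injective
on a free Toeplitz subshift, then the image is free and Toeplitz. -/
theorem isFreeToeplitz_map {φ θ : (G → Bool) → (G → Bool)} (hφ : Continuous φ)
    (hequiv : ∀ g x, φ (shift g x) = shift g (φ x))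
    (htoep : ∀ x, IsToeplitzWord x → IsToeplitzWord (φ x)) (S : FreeToeplitzSubshift G)
    (hθφ : ∀ x ∈ S.1, θ (φ x) = x) :
    IsToeplitzSubshift (S.1.map φ hφ) ∧ IsFreeSubshift (S.1.map φ hφ) := by
  obtain ⟨S, ⟨hsub, x, hx, hSx⟩, hfree⟩ := S
  refine ⟨⟨?_, φ x, htoep x hx, ?_⟩, ?_⟩
  · rintro g _ ⟨y, hy, rfl⟩
    exact ⟨shift g y, hsub g y hy, hequiv g y⟩
  · have hc : IsCompact (closure (Set.range fun g => shift g x)) := isClosed_closure.isCompact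
    rw [NonemptyCompacts.coe_map, hSx, image_closure_of_isCompact hc hφ.continuousOn,
      ← Set.range_comp]
    congr 2
    ext g : 1
    exact hequiv g x
  · rintro _ ⟨y, hy, rfl⟩ g hg h
    refine hfree y hy g hg ?_
    rw [← hequiv] at h
    have := congrArg θ h
    rwa [hθφ y hy, hθφ _ (hsub g y hy)] at this

theorem conjugate_map {φ θ : (G → Bool) → (G → Bool)} (hφ : Continuous φ) (hθ : Continuous θ)
    (hequiv : ∀ g x, φ (shift g x) = shift g (φ x)) (S : NonemptyCompacts (G → Bool))
    (hθφ : ∀ x ∈ S, θ (φ x) = x) : Conjugate S (S.map φ hφ) := by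
  have hmem : ∀ y ∈ S.map φ hφ, θ y ∈ S := by
    rintro _ ⟨x, hx, rfl⟩
    rwa [hθφ x hx]
  refine ⟨{ toFun := fun x => ⟨φ x, x, x.2, rfl⟩, invFun := fun y => ⟨θ y, hmem y y.2⟩,
            left_inv := fun x => Subtype.ext (hθφ x x.2), right_inv := ?_,
            continuous_toFun := (hφ.comp continuous_subtype_val).subtype_mk _,
            continuous_invFun := (hθ.comp continuous_subtype_val).subtype_mk _ }, ?_⟩
  · rintro ⟨_, x, hx, rfl⟩
    exact Subtype.ext (congrArg φ (hθφ x hx))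
  · rintro g x y h
    exact (congrArg φ h).trans (hequiv g x)

open Classical in
/-- The block code `2^G → 2^G` with local rule the indicator function of `C`. -/
noncomputable def blockCode (C : Set (G → Bool)) (x : G → Bool) : G → Bool :=
  fun h => decide (shift h⁻¹ x ∈ C)

theorem blockCode_shift (C : Set (G → Bool)) (g : G) (x : G → Bool) :
    blockCode C (shift g x) = shift g (blockCode C x) := by
  ext h
  simp [blockCode, shift_shift, shift]

theorem continuous_decide_mem {α : Type*} [TopologicalSpace α] {C : Set α} (hC : IsClopen C)
    [DecidablePred (· ∈ C)] : Continuous fun x => decide (x ∈ C) := by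
  rw [continuous_discrete_rng]
  rintro (_ | _)
  · convert hC.compl.isOpen using 1
    ext; simp
  · convert hC.isOpen using 1
    ext; simp

theorem continuous_blockCode {C : Set (G → Bool)} (hC : IsClopen C) :
    Continuous (blockCode C) := by
  classical
  exact continuous_pi fun h => (continuous_decide_mem hC).comp (continuous_shift h⁻¹)

theorem IsToeplitzWord.blockCode {C : Set (G → Bool)} (hC : IsClopen C) {x : G → Bool}
    (hx : IsToeplitzWord x) : IsToeplitzWord (blockCode C x) := by
  classical
  let := profiniteTopology G
  have h1 : Continuous fun h : G => shift h⁻¹ x := by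
    refine continuous_pi fun t => ?_
    have h2 : Continuous (x ∘ fun h => h * t) :=
      Continuous.comp hx (continuous_mul_right_profinite t)
    simpa [shift, Function.comp_def] using h2
  exact (continuous_decide_mem hC).comp h1

/-- Curtis–Hedlund–Lyndon: an equivariant homeomorphism between subshifts is given by a block
code. -/
theorem exists_blockCode_eq {S T : NonemptyCompacts (G → Bool)} (hS : IsSubshift S)
    {f : S → T} (hf : Continuous f) (hequiv : ∀ (g : G) (x y : S),
      (y : G → Bool) = shift g (x : G → Bool) → (f y : G → Bool) = shift g (f x : G → Bool)) :
    ∃ C : Clopens (G → Bool), ∀ x : S, blockCode (C : Set (G → Bool)) x = f x := by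
  have hcl : ∀ b : Bool, IsClosed (Subtype.val '' {x : S | (f x : G → Bool) 1 = b}) := by
    intro b
    refine (S.isCompact.isClosed.isClosedEmbedding_subtypeVal.isClosedMap) _ ?_
    exact isClosed_eq ((continuous_apply 1).comp (continuous_subtype_val.comp hf)) continuous_const
  obtain ⟨C, hC, h1, h2⟩ := exists_clopen_of_closed_subset_open (hcl true)
    (hcl false).isOpen_compl (by
      rintro _ ⟨x, hx, rfl⟩ ⟨y, hy, hxy⟩
      rw [Subtype.ext hxy] at hy
      simp_all)
  refine ⟨⟨C, hC⟩, fun x => ?_⟩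
  ext h
  let y : S := ⟨shift h⁻¹ x, hS _ _ x.2⟩
  have hy : (f y : G → Bool) 1 = (f x : G → Bool) h := by
    rw [hequiv h⁻¹ x y rfl]
    simp [shift]
  have hiff : shift h⁻¹ (x : G → Bool) ∈ C ↔ (f x : G → Bool) h = true := by
    rw [← hy]
    refine ⟨fun hm => ?_, fun hm => h1 ⟨y, hm, rfl⟩⟩
    by_contra hne
    exact h2 hm ⟨y, by simpa using hne, rfl⟩
  simp [_root_.blockCode, hiff]

open Classical in
/-- The partial map `S ↦ blockCode C '' S` on free Toeplitz subshifts, defined when the block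
code `D` inverts `C` on `S`, and extended by the identity. -/
noncomputable def blockCodeMap (C D : Clopens (G → Bool)) (S : FreeToeplitzSubshift G) :
    FreeToeplitzSubshift G :=
  if h : ∀ x ∈ S.1, blockCode D (blockCode C x) = x then
    ⟨S.1.map (blockCode C) (continuous_blockCode C.isClopen),
      isFreeToeplitz_map _ (blockCode_shift _) (fun _ => IsToeplitzWord.blockCode C.isClopen) S h⟩
  else S

theorem conjugacy_blockCodeMap (C D : Clopens (G → Bool)) (S : FreeToeplitzSubshift G) :
    (conjugacy G).r S (blockCodeMap C D S) := by
  unfold blockCodeMap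
  split_ifs with h
  · exact conjugate_map _ (continuous_blockCode D.isClopen) (blockCode_shift _) S.1 h
  · exact (conjugacy G).refl S

theorem conjugacy_iff_exists_blockCodeMap (S T : FreeToeplitzSubshift G) :
    (conjugacy G).r S T ↔ ∃ C D, blockCodeMap C D S = T := by
  constructor
  · rintro ⟨f, hf⟩
    obtain ⟨C, hC⟩ := exists_blockCode_eq S.2.1.1 f.continuous hf
    obtain ⟨D, hD⟩ := exists_blockCode_eq T.2.1.1 f.symm.continuous (by
      intro g x y h
      have hmem := S.2.1.1 g _ (f.symm x).2
      have h1 := hf g (f.symm x) ⟨_, hmem⟩ rfl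
      rw [f.apply_symm_apply, ← h] at h1
      rw [← Subtype.ext h1, f.symm_apply_apply])
    have hDC : ∀ x ∈ S.1, blockCode D (blockCode C x) = x := by
      intro x hx
      rw [hC ⟨x, hx⟩, hD, f.symm_apply_apply]
    refine ⟨C, D, ?_⟩
    rw [blockCodeMap, dif_pos hDC]
    refine Subtype.ext (SetLike.coe_injective ?_)
    rw [NonemptyCompacts.coe_map]
    ext y
    constructor
    · rintro ⟨x, hx, rfl⟩
      rw [hC ⟨x, hx⟩]
      exact (f ⟨x, hx⟩).2
    · intro hy
      exact ⟨f.symm ⟨y, hy⟩, (f.symm ⟨y, hy⟩).2, by rw [hC, f.apply_symm_apply]⟩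
  · rintro ⟨C, D, rfl⟩
    exact conjugacy_blockCodeMap C D S

theorem measurable_blockCodeMap (C D : Clopens (G → Bool)) :
    Measurable (blockCodeMap C D : FreeToeplitzSubshift G → _) := by
  classical
  have hD := (continuous_blockCode D.isClopen).comp (continuous_blockCode C.isClopen)
  have hcond : MeasurableSet
      {S : FreeToeplitzSubshift G | ∀ x ∈ S.1, blockCode D (blockCode C x) = x} :=
    measurable_subtype_coe
      (NonemptyCompacts.isClosed_subsets_of_isClosed (isClosed_eq hD continuous_id)).measurableSet
  refine measurable_comap_iff.2 ?_
  have : Measurable fun S : FreeToeplitzSubshift G =>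
      if ∀ x ∈ S.1, blockCode D (blockCode C x) = x then
        S.1.map (blockCode C) (continuous_blockCode C.isClopen) else S.1 :=
    Measurable.ite hcond
      ((continuous_blockCode C.isClopen).nonemptyCompacts_map.measurable.comp
        measurable_subtype_coe) measurable_subtype_coe
  convert this using 2 with S
  simp only [Function.comp_apply, blockCodeMap]
  split_ifs <;> rfl

variable [Countable G]

variable (G) in
/-- The conjugacy class of a free Toeplitz subshift is enumerated by countably many
measurable maps. -/
theorem exists_enumeration_conjugacy :
    ∃ ψ : ℕ → FreeToeplitzSubshift G → FreeToeplitzSubshift G, (∀ i, Measurable (ψ i)) ∧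
      ∀ S T, (conjugacy G).r S T ↔ ∃ i, ψ i S = T := by
  have : Countable (Clopens (G → Bool)) :=
    Clopens.countable_iff_secondCountable.2 inferInstance
  obtain ⟨e, he⟩ := exists_surjective_nat (Clopens (G → Bool) × Clopens (G → Bool))
  refine ⟨fun i => blockCodeMap (e i).1 (e i).2, fun i => measurable_blockCodeMap _ _,
    fun S T => ?_⟩
  rw [conjugacy_iff_exists_blockCodeMap, ← Prod.exists (p := fun p => blockCodeMap p.1 p.2 S = T)]
  exact he.exists

instance : MeasurableEq (FreeToeplitzSubshift G) := by
  have : SecondCountableTopology (FreeToeplitzSubshift G) :=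
    Subtype.secondCountableTopology _
  exact ⟨isClosed_diagonal.measurableSet⟩

end BlockCodes

/-! ### A function without symmetries on a profinite group -/

section RigidFunction

/-- A dense embedding of `G` into a profinite group `K` together with a strictly decreasing
sequence of open normal subgroups of `K`, starting with `K`, that form a neighbourhood basis
at `1`. -/
structure ProfiniteChain (G K : Type*) [Group G] [Group K] [TopologicalSpace K] where
  /-- The embedding. -/
  ι : G →* K
  /-- The open normal subgroups. -/
  N : ℕ → Subgroup K
  injective : Function.Injective ι
  dense : DenseRange ι
  normal : ∀ n, (N n).Normal
  isOpen : ∀ n, IsOpen (N n : Set K)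
  zero : N 0 = ⊤
  strictAnti : StrictAnti N
  basis : ∀ U ∈ 𝓝 (1 : K), ∃ n, (N n : Set K) ⊆ U

namespace ProfiniteChain

variable {G K : Type*} [Group G] [Group K] [TopologicalSpace K] (P : ProfiniteChain G K)

instance (n : ℕ) : (P.N n).Normal := P.normal n

theorem le_of_le {m n : ℕ} (h : m ≤ n) : P.N n ≤ P.N m := P.strictAnti.antitone h

theorem eq_one [T2Space K] {u : K} (h : ∀ n, u ∈ P.N n) : u = 1 := by
  by_contra hu
  obtain ⟨n, hn⟩ := P.basis _
    (isOpen_compl_singleton.mem_nhds (Ne.symm hu : (1 : K) ∈ ({u}ᶜ : Set K)))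
  exact hn (h n) rfl

theorem exists_mem_notMem (n : ℕ) : ∃ v ∈ P.N n, v ∉ P.N (n + 1) :=
  SetLike.exists_of_lt (P.strictAnti n.lt_succ_self)

/-- The least `n` with `u ∉ N (n + 1)`, so that `u ∈ N n`; it is `0` for `u = 1`. -/
noncomputable def level (u : K) : ℕ := sInf {n | u ∉ P.N (n + 1)}

theorem mem_level (u : K) : u ∈ P.N (P.level u) := by
  rcases h : P.level u with _ | m
  · rw [P.zero]; trivial
  · by_contra hu
    have : P.level u ≤ m := Nat.sInf_le hu
    omega

theorem notMem_level_succ [T2Space K] {u : K} (hu : u ≠ 1) : u ∉ P.N (P.level u + 1) := by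
  have : {n | u ∉ P.N (n + 1)}.Nonempty := by
    by_contra hne
    rw [Set.not_nonempty_iff_eq_empty, Set.eq_empty_iff_forall_notMem] at hne
    exact hu (P.eq_one fun n => P.le_of_le n.le_succ (not_not.1 (hne n)))
  exact Nat.sInf_mem this

theorem level_eq {u : K} {n : ℕ} (h1 : u ∈ P.N n) (h2 : u ∉ P.N (n + 1)) : P.level u = n := by
  refine le_antisymm (Nat.sInf_le h2) (le_csInf ⟨n, h2⟩ fun b hb => ?_)
  by_contra hbn
  exact hb (P.le_of_le (by omega) h1)

theorem level_conj (b v : K) : P.level (b⁻¹ * v * b) = P.level v := by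
  unfold level
  congr 1
  ext n
  have := (P.normal (n + 1)).mem_comm_iff (a := b⁻¹ * v) (b := b)
  rw [mul_inv_cancel_left] at this
  exact not_congr this

theorem level_mul [T2Space K] {u v : K} (hu : u ≠ 1) (hv : v ∈ P.N (P.level u + 1)) :
    P.level (u * v) = P.level u ∧ u * v ≠ 1 := by
  have h : u * v ∉ P.N (P.level u + 1) := fun h =>
    P.notMem_level_succ hu (((P.N _).mul_mem_cancel_right hv).1 h)
  exact ⟨P.level_eq (mul_mem (P.mem_level u) (P.le_of_le (Nat.le_succ _) hv)) h,
    fun h1 => h (h1 ▸ one_mem _)⟩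

theorem exists_level_ge {c : ℕ → G} (hc : ∀ g m, ∃ n ≥ m, c n = g) (g : G) (m : ℕ) :
    ∃ v ∈ P.N m, v ≠ 1 ∧ c (P.level v) = g := by
  obtain ⟨n, hn, hcn⟩ := hc g m
  obtain ⟨v, h1, h2⟩ := P.exists_mem_notMem n
  refine ⟨v, P.le_of_le hn h1, ?_, by rw [P.level_eq h1 h2, hcn]⟩
  rintro rfl
  exact h2 (one_mem _)

section

variable [IsTopologicalGroup K]

theorem exists_rep (n : ℕ) (q : K ⧸ P.N n) : ∃ g : G, (P.ι g : K ⧸ P.N n) = q := by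
  obtain ⟨u, rfl⟩ := QuotientGroup.mk_surjective q
  obtain ⟨g, v, hv, hg⟩ := P.dense.exists_mem_open (s := (u * ·) '' (P.N n : Set K))
    ((isOpenMap_mul_left u) _ (P.isOpen n)) ⟨u * 1, 1, one_mem _, rfl⟩
  exact ⟨g, by rw [← hg]; exact QuotientGroup.mk_mul_of_mem u hv⟩

/-- A representative in `G` of the coset of `u` modulo `N n`. -/
noncomputable def rep (n : ℕ) (u : K) : G := (P.exists_rep n (u : K ⧸ P.N n)).choose

theorem rep_spec (n : ℕ) (u : K) : u⁻¹ * P.ι (P.rep n u) ∈ P.N n :=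
  QuotientGroup.eq.1 (P.exists_rep n (u : K ⧸ P.N n)).choose_spec.symm

theorem rep_mul (n : ℕ) (u : K) {v : K} (hv : v ∈ P.N n) : P.rep n (u * v) = P.rep n u := by
  simp only [rep, QuotientGroup.mk_mul_of_mem u hv]

/-- The leading digit of `u`: a representative in `G` of the coset of `u` modulo `N (n + 1)`, where
`n` is the level of `u`. -/
noncomputable def lead (u : K) : G := P.rep (P.level u + 1) u

theorem lead_spec (u : K) : u⁻¹ * P.ι (P.lead u) ∈ P.N (P.level u + 1) := P.rep_spec _ u

/-- The set of all elements of `K` other than `1` and the markers. -/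
def regularSet : Set K := {u | u ≠ 1 ∧ u ≠ P.ι (P.lead u)}

theorem mem_regularSet {u : K} (hu : u ∉ Set.range P.ι) : u ∈ P.regularSet :=
  ⟨fun h => hu ⟨1, by rw [h, map_one]⟩, fun h => hu ⟨_, h.symm⟩⟩

variable [T2Space K]

theorem lead_mul {u v : K} (hu : u ≠ 1) (hv : v ∈ P.N (P.level u + 1)) :
    P.lead (u * v) = P.lead u := by
  rw [lead, (P.level_mul hu hv).1, P.rep_mul _ u hv, lead]

/-- `ι g ≠ 1` is the leading digit of some element, equivalently, of itself. -/
def IsMarker (g : G) : Prop := P.ι g ≠ 1 ∧ P.lead (P.ι g) = g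

theorem lead_isMarker {u : K} (hu : u ≠ 1) :
    P.IsMarker (P.lead u) ∧ P.level (P.ι (P.lead u)) = P.level u := by
  have h := P.lead_spec u
  have h1 := P.level_mul hu h
  have h2 := P.lead_mul hu h
  rw [mul_inv_cancel_left] at h1 h2
  exact ⟨⟨h1.2, h2⟩, h1.1⟩

theorem exists_isMarker (n : ℕ) : ∃ g, P.IsMarker g ∧ P.level (P.ι g) = n := by
  obtain ⟨v, h1, h2⟩ := P.exists_mem_notMem n
  have h3 : v ≠ 1 := by
    rintro rfl
    exact h2 (one_mem _)
  obtain ⟨h4, h5⟩ := P.lead_isMarker h3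
  exact ⟨_, h4, h5.trans (P.level_eq h1 h2)⟩

variable (c : ℕ → G)

open Classical in
/-- A function on `K` that is locally constant at all points of `regularSet`. Near a marker `ι g`,
its value at `ι g * v` tells whether `c (level v) = g`; if `c` takes every value infinitely often,
this oscillation identifies the marker. -/
noncomputable def rigidFun (u : K) : Bool :=
  decide (c (P.level ((P.ι (P.lead u))⁻¹ * u)) = P.lead u)

theorem rigidFun_locally_const {u : K} (hu : u ∈ P.regularSet) :
    ∃ n, ∀ v ∈ P.N n, u * v ∈ P.regularSet ∧ P.rigidFun c (u * v) = P.rigidFun c u := by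
  obtain ⟨h1, h2⟩ := hu
  have hw : (P.ι (P.lead u))⁻¹ * u ≠ 1 := fun h => h2 (inv_mul_eq_one.1 h).symm
  refine ⟨max (P.level u + 1) (P.level ((P.ι (P.lead u))⁻¹ * u) + 1), fun v hv => ?_⟩
  have hv1 := P.le_of_le (le_max_left _ _) hv
  have hv2 := P.le_of_le (le_max_right _ _) hv
  have h3 := P.level_mul h1 hv1
  have h4 := P.lead_mul h1 hv1
  have h5 := P.level_mul hw hv2
  rw [mul_assoc] at h5
  refine ⟨⟨h3.2, fun h => h5.2 ?_⟩, ?_⟩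
  · rw [h4] at h
    rw [h, inv_mul_cancel]
  · rw [rigidFun, rigidFun, h4, h5.1]

theorem rigidFun_marker {g : G} (hg : P.IsMarker g) {v : K}
    (hv : v ∈ P.N (P.level (P.ι g) + 1)) (hv1 : v ≠ 1) :
    P.ι g * v ∈ P.regularSet ∧ (P.rigidFun c (P.ι g * v) = true ↔ c (P.level v) = g) := by
  have h1 := P.level_mul hg.1 hv
  have h2 := P.lead_mul hg.1 hv
  rw [hg.2] at h2
  refine ⟨⟨h1.2, ?_⟩, ?_⟩
  · rw [h2]
    simpa using hv1
  · simp [rigidFun, h2]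

variable [Nontrivial G]

/-- Markers are fixed by symmetries of `rigidFun`, since the behaviour of the function at `1`, at
the markers and at other points are pairwise different. -/
theorem marker_fixed (hc : ∀ g m, ∃ n ≥ m, c n = g) {a b : K}
    (hab : ∀ v ∈ P.regularSet, a * v * b ∈ P.regularSet →
      P.rigidFun c (a * v * b) = P.rigidFun c v) {g : G} (hg : P.IsMarker g) :
    a * P.ι g * b = P.ι g := by
  -- The oscillation at `ι g` is carried to `w`, since conjugation by `b` preserves levels.
  set w := a * P.ι g * b with hw
  set m₀ := P.level (P.ι g) + 1 with hm₀
  have key : ∀ v ∈ P.N m₀, v ≠ 1 → w * v ∈ P.regularSet →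
      (P.rigidFun c (w * v) = true ↔ c (P.level v) = g) := by
    intro v hv hv1 hwv
    have h1 : b * v * b⁻¹ ∈ P.N m₀ := (P.normal m₀).conj_mem v hv b
    have h2 : b * v * b⁻¹ ≠ 1 := by simpa [mul_inv_eq_one] using hv1
    have h3 := P.rigidFun_marker c hg h1 h2
    have h4 : a * (P.ι g * (b * v * b⁻¹)) * b = w * v := by
      rw [hw]; group
    have h5 := hab _ h3.1 (by rwa [h4])
    have h6 : P.level (b * v * b⁻¹) = P.level v := by
      simpa using P.level_conj b⁻¹ v
    rw [← h4, h5, h3.2, h6]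
  -- If `w` were regular, the function would be constant near `w`.
  by_cases hwr : w ∈ P.regularSet
  · obtain ⟨n, hn⟩ := P.rigidFun_locally_const c hwr
    obtain ⟨g', hg'⟩ := exists_ne g
    obtain ⟨v, h1, h2, h3⟩ := P.exists_level_ge hc g (max n m₀)
    obtain ⟨v', h1', h2', h3'⟩ := P.exists_level_ge hc g' (max n m₀)
    have hv := hn v (P.le_of_le (le_max_left _ _) h1)
    have hv' := hn v' (P.le_of_le (le_max_left _ _) h1')
    have k := (key v (P.le_of_le (le_max_right _ _) h1) h2 hv.1).2 h3
    have k' := mt (key v' (P.le_of_le (le_max_right _ _) h1') h2' hv'.1).1 (by rwa [h3'])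
    rw [hv.2] at k
    rw [hv'.2] at k'
    exact absurd k k'
  · by_cases hw1 : w = 1
    · -- Near `1`, the function takes the value `false` somewhere on each `N m \ N (m + 1)`,
      -- whereas `key` demands `true` if `c m = g`.
      exfalso
      obtain ⟨m, hm, hcm⟩ := hc g m₀
      obtain ⟨d, hd, hdm⟩ := P.exists_isMarker m
      obtain ⟨g', hg'⟩ := exists_ne d
      obtain ⟨v, h1, h2, h3⟩ := P.exists_level_ge hc g' (m + 1)
      rw [← hdm] at h1
      have h4 := P.rigidFun_marker c hd h1 h2
      have h5 := P.level_mul hd.1 h1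
      have h6 : P.ι d * v ∈ P.N m₀ := by
        refine P.le_of_le hm ?_
        have := P.mem_level (P.ι d * v)
        rwa [h5.1, hdm] at this
      have h7 := key _ h6 h5.2 (by rw [hw1, one_mul]; exact h4.1)
      rw [hw1, one_mul, h4.2, h3, h5.1, hdm] at h7
      exact hg' (h7.2 hcm)
    · have hwl : w = P.ι (P.lead w) := by
        by_contra h
        exact hwr ⟨hw1, h⟩
      obtain ⟨h1, h2⟩ := P.lead_isMarker hw1
      obtain ⟨v, h3, h4, h5⟩ := P.exists_level_ge hc g (max m₀ (P.level w + 1))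
      have h6 := P.rigidFun_marker c h1 (v := v)
        (by rw [h2]; exact P.le_of_le (le_max_right _ _) h3) h4
      rw [← hwl] at h6
      have h7 := (h6.2.1 ((key v (P.le_of_le (le_max_left _ _) h3) h4 h6.1).2 h5))
      rw [hwl, ← h7, h5]

/-- `rigidFun` has no two-sided translational symmetries: such a symmetry fixes all markers;
these accumulate at `1` and generate a dense subgroup. -/
theorem rigidFun_rigid (hc : ∀ g m, ∃ n ≥ m, c n = g) {a b : K}
    (hab : ∀ v ∈ P.regularSet, a * v * b ∈ P.regularSet →
      P.rigidFun c (a * v * b) = P.rigidFun c v) (u : K) :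
    a * u * b = u := by
  have hfix := fun g => P.marker_fixed c hc hab (g := g)
  have h1 : a * b = 1 := by
    refine P.eq_one fun m => ?_
    obtain ⟨g, hg, hgm⟩ := P.exists_isMarker m
    have h2 : P.ι g ∈ P.N m := hgm ▸ P.mem_level _
    have h3 : a * b = P.ι g * (b⁻¹ * (P.ι g)⁻¹ * b⁻¹⁻¹) := by
      nth_rewrite 1 [← hfix g hg]
      group
    rw [h3]
    exact mul_mem h2 ((P.normal m).conj_mem _ (inv_mem h2) _)
  obtain rfl := eq_inv_of_mul_eq_one_right h1
  -- Every `u` is, modulo `N m`, a product of leading digits, which commute with `a`.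
  have happrox : ∀ m, ∃ p, a * p * a⁻¹ = p ∧ p⁻¹ * u ∈ P.N m := by
    intro m
    induction m with
    | zero => exact ⟨1, by simp, by rw [P.zero]; trivial⟩
    | succ m ih =>
      obtain ⟨p, hp, hpu⟩ := ih
      by_cases hm : p⁻¹ * u ∈ P.N (m + 1)
      · exact ⟨p, hp, hm⟩
      · have hne : p⁻¹ * u ≠ 1 := fun h => hm (h ▸ one_mem _)
        have hl := P.lead_spec (p⁻¹ * u)
        rw [P.level_eq hpu hm] at hl
        refine ⟨p * P.ι (P.lead (p⁻¹ * u)), ?_, ?_⟩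
        · have := hfix _ (P.lead_isMarker hne).1
          rw [show a * (p * P.ι (P.lead (p⁻¹ * u))) * a⁻¹
            = a * p * a⁻¹ * (a * P.ι (P.lead (p⁻¹ * u)) * a⁻¹) by group, hp, this]
        · rw [← inv_mem_iff]
          simpa [mul_assoc] using hl
  rw [← mul_inv_eq_one]
  refine P.eq_one fun m => ?_
  obtain ⟨p, hp, hpu⟩ := happrox m
  have : a * u * a⁻¹ * u⁻¹ = p * (a * (p⁻¹ * u) * a⁻¹ * (p⁻¹ * u)⁻¹) * p⁻¹ := by
    nth_rewrite 1 [← hp]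
    group
  rw [this]
  exact (P.normal m).conj_mem _
    (mul_mem ((P.normal m).conj_mem _ hpu a) (inv_mem hpu)) p

end

end ProfiniteChain

end RigidFunction

/-! ### Dense embeddings into profinite groups -/

section Existence

universe u

/-- The profinite group is the closure of `G` in `∏ i, Q i`; the chain is a strictly decreasing
subsequence of the subgroups of elements with trivial first `n` coordinates. -/
theorem exists_profiniteChain_of_injective {G : Type u} [Group G] [Infinite G]
    {Q : ℕ → Type u} [∀ i, Group (Q i)] [∀ i, Finite (Q i)] [∀ i, TopologicalSpace (Q i)]
    [∀ i, DiscreteTopology (Q i)] (π : G →* ∀ i, Q i) (hπ : Function.Injective π) :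
    ∃ (K : Type u) (_ : Group K) (_ : TopologicalSpace K) (_ : IsTopologicalGroup K)
      (_ : CompactSpace K) (_ : T2Space K), Nonempty (ProfiniteChain G K) := by
  let K : Subgroup (∀ i, Q i) := π.range.topologicalClosure
  have hKc : CompactSpace K :=
    isCompact_iff_compactSpace.1 (Subgroup.isClosed_topologicalClosure π.range).isCompact
  let ι : G →* K := π.codRestrict K fun g => Subgroup.le_topologicalClosure _ ⟨g, rfl⟩
  have hι : Function.Injective ι := fun g h hgh => hπ (congrArg Subtype.val hgh)
  have hdense : DenseRange ι := by
    intro u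
    rw [closure_subtype, ← Set.range_comp]
    exact u.2
  have hKinf : Infinite K := Infinite.of_injective ι hι
  -- the elements of `K` whose first `n` coordinates are trivial
  let M : ℕ → Subgroup K := fun n => ⨅ i, ⨅ _ : i < n, ((Pi.evalMonoidHom Q i).comp K.subtype).ker
  have hM : ∀ n u, u ∈ M n ↔ ∀ i < n, u.1 i = 1 := by
    intro n u
    simp [M, Subgroup.mem_iInf, MonoidHom.mem_ker]
  have hMnormal : ∀ n, (M n).Normal := fun n =>
    ⟨fun u hu v => (hM _ _).2 fun i hi => by simp [(hM _ _).1 hu i hi]⟩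
  have hMopen : ∀ n, IsOpen (M n : Set K) := by
    intro n
    have : (M n : Set K) = ⋂ i ∈ Set.Iio n, {u : K | u.1 i = 1} := by
      ext u
      simp [hM]
    rw [this]
    exact (Set.finite_Iio n).isOpen_biInter fun i _ =>
      (isOpen_discrete {(1 : Q i)}).preimage ((continuous_apply i).comp continuous_subtype_val)
  have hManti : Antitone M := fun m n hmn u hu =>
    (hM _ _).2 fun i hi => (hM _ _).1 hu i (hi.trans_le hmn)
  have hM0 : M 0 = ⊤ := by
    ext u
    simp [hM]
  have hMbasis : ∀ U ∈ 𝓝 (1 : K), ∃ n, (M n : Set K) ⊆ U := by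
    intro U hU
    rw [nhds_subtype, mem_comap] at hU
    obtain ⟨V, hV, hVU⟩ := hU
    rw [nhds_pi, Filter.mem_pi] at hV
    obtain ⟨I, hI, t, ht, htV⟩ := hV
    obtain ⟨n, hn⟩ := hI.bddAbove
    refine ⟨n + 1, fun u hu => hVU (htV fun i hi => ?_)⟩
    rw [(hM _ _).1 hu i (Nat.lt_succ_of_le (hn hi))]
    exact mem_of_mem_nhds (ht i)
  have hMlt : ∀ n, ∃ m, n < m ∧ M m < M n := by
    intro n
    by_contra! h
    have heq : ∀ m, n < m → M m = M n := fun m hm =>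
      (hManti hm.le).lt_or_eq.resolve_left (h m hm)
    have hbot : (M n : Set K) = {1} := by
      ext u
      constructor
      · intro hu
        refine Subtype.ext (funext fun i => ?_)
        have : u ∈ M (max n i + 1) := by
          rw [heq _ (by omega)]
          exact hu
        exact (hM _ _).1 this i (by omega)
      · rintro rfl
        exact one_mem _
    have hd : DiscreteTopology K := discreteTopology_of_isOpen_singleton_one (hbot ▸ hMopen n)
    have : Finite K := finite_of_compact_of_discrete
    exact not_finite K
  choose s hs hsM using hMlt
  have hmono : StrictMono fun k => s^[k] 0 := strictMono_nat_of_lt_succ fun k => by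
    rw [Function.iterate_succ_apply']
    exact hs _
  refine ⟨K, inferInstance, inferInstance, inferInstance, hKc, inferInstance, ⟨
    { ι := ι, N := fun k => M (s^[k] 0), injective := hι, dense := hdense,
      normal := fun k => hMnormal _, isOpen := fun k => hMopen _, zero := hM0,
      strictAnti := strictAnti_nat_of_succ_lt fun k => ?_, basis := fun U hU => ?_ }⟩⟩
  · rw [Function.iterate_succ_apply']
    exact hsM _
  · obtain ⟨n, hn⟩ := hMbasis U hU
    exact ⟨n, fun u hu => hn (hManti (hmono.id_le n) hu)⟩

theorem exists_profiniteChain (G : Type u) [Group G] [Countable G] [Group.ResiduallyFinite G]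
    [Infinite G] :
    ∃ (K : Type u) (_ : Group K) (_ : TopologicalSpace K) (_ : IsTopologicalGroup K)
      (_ : CompactSpace K) (_ : T2Space K), Nonempty (ProfiniteChain G K) := by
  obtain ⟨e, he⟩ := exists_surjective_nat G
  have hex : ∀ g : G, ∃ H : FiniteIndexNormalSubgroup G, g ≠ 1 → g ∉ H := by
    intro g
    by_cases hg : g = 1
    · exact ⟨FiniteIndexNormalSubgroup.ofSubgroup ⊤, fun h => (h hg).elim⟩
    · obtain ⟨H, hH⟩ := Group.exists_finiteIndexNormalSubgroup_notMem g hg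
      exact ⟨H, fun _ => hH⟩
  choose H hH using hex
  let _ : ∀ i, TopologicalSpace (G ⧸ (H (e i)).toSubgroup) := fun _ => ⊥
  have _ : ∀ i, DiscreteTopology (G ⧸ (H (e i)).toSubgroup) := fun _ => ⟨rfl⟩
  refine exists_profiniteChain_of_injective (Q := fun i => G ⧸ (H (e i)).toSubgroup)
    (MonoidHom.pi fun i => QuotientGroup.mk' (H (e i)).toSubgroup) ?_
  rw [injective_iff_map_eq_one]
  intro g hg
  obtain ⟨i, hi⟩ := he g
  by_contra hne
  have h1 : (g : G ⧸ (H (e i)).toSubgroup) = 1 := congrFun hg i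
  rw [QuotientGroup.eq_one_iff, hi] at h1
  exact hH g hne h1

end Existence

/-! ### The Toeplitz subshifts of the function -/

section Words

namespace ProfiniteChain

variable {G K : Type*} [Group G] [Group K] [TopologicalSpace K] (P : ProfiniteChain G K)
  (c : ℕ → G)

theorem smul_notMem_range {k : K} (hk : k ∉ Set.range P.ι) (h : G) :
    P.ι h * k ∉ Set.range P.ι := by
  rintro ⟨g, hg⟩
  exact hk ⟨h⁻¹ * g, by simp [hg]⟩

variable [IsTopologicalGroup K]

/-- The word `h ↦ rigidFun (ι h * k)`. -/
noncomputable def word (k : K) : G → Bool := fun h => P.rigidFun c (P.ι h * k)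

theorem mem_nhds_coset (u : K) (n : ℕ) : {v | u⁻¹ * v ∈ P.N n} ∈ 𝓝 u :=
  ((P.isOpen n).preimage (continuous_const_mul u⁻¹)).mem_nhds (by simp)

theorem word_mul (g : G) (k : K) : P.word c (P.ι g * k) = fun h => P.word c k (h * g) := by
  ext h
  simp [word, mul_assoc]

/-- The orbit closure of `word k`. -/
noncomputable def orbitClosure (k : K) : NonemptyCompacts (G → Bool) where
  carrier := closure (Set.range fun g : G => shift g (P.word c k))
  isCompact' := isClosed_closure.isCompact
  nonempty' := (Set.range_nonempty _).closure

theorem coe_orbitClosure (k : K) : (P.orbitClosure c k : Set (G → Bool)) =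
    closure (Set.range fun g : G => shift g (P.word c k)) := rfl

theorem word_mem_orbitClosure (k : K) : P.word c k ∈ P.orbitClosure c k :=
  subset_closure ⟨1, shift_one _⟩

theorem isSubshift_orbitClosure (k : K) : IsSubshift (P.orbitClosure c k) := by
  intro g x hx
  refine map_mem_closure (continuous_shift g) hx ?_
  rintro _ ⟨h, rfl⟩
  exact ⟨g * h, (shift_shift g h _).symm⟩

theorem orbitClosure_mul (g : G) (k : K) : P.orbitClosure c (P.ι g * k) =
    (P.orbitClosure c k).map (fun x h => x (h * g)) (by fun_prop) := by
  refine SetLike.coe_injective ?_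
  have hc : IsCompact (closure (Set.range fun g => shift g (P.word c k))) :=
    isClosed_closure.isCompact
  rw [NonemptyCompacts.coe_map, coe_orbitClosure, coe_orbitClosure,
    image_closure_of_isCompact hc (by fun_prop), ← Set.range_comp, word_mul]
  congr 2
  ext h t
  simp [shift, mul_assoc]

theorem conjugate_orbitClosure (g : G) (k : K) :
    Conjugate (P.orbitClosure c k) (P.orbitClosure c (P.ι g * k)) := by
  rw [orbitClosure_mul]
  refine conjugate_map (θ := fun x h => x (h * g⁻¹)) _ (by fun_prop) (fun h x => ?_) _
    (fun x _ => ?_)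
  · ext t
    simp [shift, mul_assoc]
  · ext t
    simp

variable [T2Space K]

theorem continuousAt_rigidFun {u : K} (hu : u ∈ P.regularSet) :
    ContinuousAt (P.rigidFun c) u := by
  obtain ⟨n, hn⟩ := P.rigidFun_locally_const c hu
  refine tendsto_const_nhds.congr' ?_
  filter_upwards [P.mem_nhds_coset u n] with v hv
  have := (hn _ hv).2
  rw [mul_inv_cancel_left] at this
  exact this.symm

/-- By density of `G`, it suffices to test symmetries of `rigidFun` on a translate of `G`. -/
theorem rigidFun_rigid_of_dense [Nontrivial G] {c : ℕ → G} (hc : ∀ g m, ∃ n ≥ m, c n = g)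
    {a b κ k : K} (hab : ∀ t : G, κ * P.ι t * k ∈ P.regularSet →
      a * (κ * P.ι t * k) * b ∈ P.regularSet →
      P.rigidFun c (a * (κ * P.ι t * k) * b) = P.rigidFun c (κ * P.ι t * k)) (u : K) :
    a * u * b = u := by
  refine P.rigidFun_rigid c hc (fun v hv hv' => ?_) u
  obtain ⟨n, hn⟩ := P.rigidFun_locally_const c hv
  obtain ⟨n', hn'⟩ := P.rigidFun_locally_const c hv'
  obtain ⟨t, ht⟩ := P.dense.exists_mem_open
    (s := {x | v⁻¹ * (κ * x * k) ∈ P.N (max n n')})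
    ((P.isOpen _).preimage (by fun_prop : Continuous fun x => v⁻¹ * (κ * x * k)))
    ⟨κ⁻¹ * v * k⁻¹, by
      rw [Set.mem_ofPred_eq, show v⁻¹ * (κ * (κ⁻¹ * v * k⁻¹) * k) = 1 by group]
      exact one_mem _⟩
  obtain ⟨h1, h2⟩ := hn _ (P.le_of_le (le_max_left _ _) ht)
  obtain ⟨h3, h4⟩ := hn' _ ((P.normal _).conj_mem _ (P.le_of_le (le_max_right _ _) ht) b⁻¹)
  rw [mul_inv_cancel_left] at h1 h2
  rw [show a * v * b * (b⁻¹ * (v⁻¹ * (κ * P.ι t * k)) * b⁻¹⁻¹)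
    = a * (κ * P.ι t * k) * b by group] at h3 h4
  rw [← h4, ← h2, hab t h1 h3]

variable [CompactSpace K]

theorem isToeplitzWord_word {k : K} (hk : k ∉ Set.range P.ι) : IsToeplitzWord (P.word c k) := by
  let := profiniteTopology G
  refine continuous_def.2 fun s _ => ?_
  intro g hg
  obtain ⟨n, hn⟩ := P.rigidFun_locally_const c (P.mem_regularSet (P.smul_notMem_range hk g))
  have : Finite (K ⧸ P.N n) := Subgroup.quotient_finite_of_isOpen _ (P.isOpen n)
  have : (P.N n).FiniteIndex := Subgroup.finiteIndex_of_finite_quotient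
  refine ⟨(P.N n).comap P.ι, ?_, fun h hh => ?_⟩
  · rw [Subgroup.finiteIndex_iff, Subgroup.index_comap]
    exact Subgroup.isFiniteRelIndex_of_finiteIndex.relIndex_ne_zero
  · have h1 : k⁻¹ * P.ι h * k⁻¹⁻¹ ∈ P.N n := (P.normal n).conj_mem _ hh _
    have h2 := (hn _ h1).2
    rw [show P.ι g * k * (k⁻¹ * P.ι h * k⁻¹⁻¹) = P.ι (g * h) * k by rw [map_mul]; group] at h2
    change P.word c k (g * h) ∈ s
    rw [word, h2]
    exact hg

/-- Every point of the orbit closure agrees, off the singularities of `rigidFun`, with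
`t ↦ rigidFun (κ * ι t * k)` for some `κ ∈ K`: choose `κ` as a limit of the translating elements. -/
theorem exists_of_mem_orbitClosure {k : K} {y : G → Bool} (hy : y ∈ P.orbitClosure c k) :
    ∃ κ : K, ∀ t : G, κ * P.ι t * k ∈ P.regularSet → y t = P.rigidFun c (κ * P.ι t * k) := by
  let Γ : Set (K × (G → Bool)) :=
    closure (Set.range fun g : G => (P.ι g⁻¹, shift g (P.word c k)))
  have hΓ : IsClosed (Prod.snd '' Γ) := (isClosed_closure.isCompact.image continuous_snd).isClosed
  have hsub : (P.orbitClosure c k : Set (G → Bool)) ⊆ Prod.snd '' Γ :=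
    closure_minimal (by rintro _ ⟨g, rfl⟩; exact ⟨_, subset_closure ⟨g, rfl⟩, rfl⟩) hΓ
  obtain ⟨⟨κ, y'⟩, hκ, rfl⟩ := hsub hy
  refine ⟨κ, fun t ht => ?_⟩
  have hc1 : ContinuousAt (fun p : K × (G → Bool) => P.rigidFun c (p.1 * P.ι t * k)) (κ, y') :=
    ContinuousAt.comp (g := P.rigidFun c) (P.continuousAt_rigidFun c ht)
      (by fun_prop : Continuous fun p : K × (G → Bool) => p.1 * P.ι t * k).continuousAt
  have hc2 : ContinuousAt (fun p : K × (G → Bool) => p.2 t) (κ, y') :=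
    (by fun_prop : Continuous fun p : K × (G → Bool) => p.2 t).continuousAt
  have hev := inter_mem
    (hc1.preimage_mem_nhds ((isOpen_discrete {P.rigidFun c (κ * P.ι t * k)}).mem_nhds rfl))
    (hc2.preimage_mem_nhds ((isOpen_discrete {y' t}).mem_nhds rfl))
  obtain ⟨_, ⟨h1, h2⟩, g, rfl⟩ := mem_closure_iff_nhds.1 hκ _ hev
  change P.rigidFun c (P.ι g⁻¹ * P.ι t * k) = _ at h1
  change shift g (P.word c k) t = y' t at h2
  change y' t = _
  rw [← h1, ← h2]
  simp [shift, word]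

variable [Nontrivial G] {c}

theorem isFreeSubshift_orbitClosure (hc : ∀ g m, ∃ n ≥ m, c n = g) (k : K) :
    IsFreeSubshift (P.orbitClosure c k) := by
  intro y hy g hg hgy
  obtain ⟨κ, hκ⟩ := P.exists_of_mem_orbitClosure c hy
  refine hg (P.injective ?_)
  have := P.rigidFun_rigid_of_dense hc (a := κ * P.ι g⁻¹ * κ⁻¹) (b := 1) (κ := κ) (k := k)
    (fun t h1 h2 => by
      have h3 : κ * P.ι g⁻¹ * κ⁻¹ * (κ * P.ι t * k) * 1 = κ * P.ι (g⁻¹ * t) * k := by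
        rw [map_mul]; group
      rw [h3] at h2 ⊢
      rw [← hκ _ h1, ← hκ _ h2]
      exact congrFun hgy t) 1
  rw [mul_one, mul_one, mul_inv_eq_one, mul_eq_left, map_inv, inv_eq_one] at this
  rw [this, map_one]

theorem isFreeToeplitz_orbitClosure (hc : ∀ g m, ∃ n ≥ m, c n = g) {k : K}
    (hk : k ∉ Set.range P.ι) :
    IsToeplitzSubshift (P.orbitClosure c k) ∧ IsFreeSubshift (P.orbitClosure c k) :=
  ⟨⟨P.isSubshift_orbitClosure c k, P.word c k, P.isToeplitzWord_word c hk, rfl⟩,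
    P.isFreeSubshift_orbitClosure hc k⟩

theorem mem_center_of_orbitClosure_eq (hc : ∀ g m, ∃ n ≥ m, c n = g) {g : G} {k : K}
    (h : P.orbitClosure c (P.ι g * k) = P.orbitClosure c k) :
    g ∈ Subgroup.center G := by
  have hmem := P.word_mem_orbitClosure c (P.ι g * k)
  rw [h] at hmem
  obtain ⟨κ, hκ⟩ := P.exists_of_mem_orbitClosure c hmem
  have key := P.rigidFun_rigid_of_dense hc (a := κ⁻¹) (b := k⁻¹ * P.ι g * k) (κ := κ) (k := k)
    (fun t h1 _ => by
      rw [show κ⁻¹ * (κ * P.ι t * k) * (k⁻¹ * P.ι g * k) = P.ι t * (P.ι g * k) by group]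
      rw [← hκ _ h1]
      rfl)
  have h1 : κ = k⁻¹ * P.ι g * k := by
    have := key 1
    rwa [mul_one, inv_mul_eq_one] at this
  rw [Subgroup.mem_center_iff]
  intro t
  refine P.injective ?_
  have h2 := key (k⁻¹ * P.ι t * k)
  rw [h1] at h2
  rw [map_mul, map_mul]
  have h3 : k * ((k⁻¹ * P.ι g * k)⁻¹ * (k⁻¹ * P.ι t * k) * (k⁻¹ * P.ι g * k)) * k⁻¹
    = (P.ι g)⁻¹ * (P.ι t * P.ι g) := by group
  rw [h2] at h3
  rw [← inv_mul_eq_iff_eq_mul, ← h3]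
  group

end ProfiniteChain

end Words

/-! ### The random subshift -/

section RandomSubshift

namespace ProfiniteChain

variable {G K : Type*} [Group G] [Group K] [TopologicalSpace K]

/-- The elements of `K` outside the image of `G`. -/
abbrev Generic (P : ProfiniteChain G K) : Type _ := {k : K // k ∉ Set.range P.ι}

variable (P : ProfiniteChain G K)

/-- The action of `G` on `K` by left multiplication preserves the complement of `G`. -/
instance : MulAction G P.Generic where
  smul g k := ⟨P.ι g * k.1, P.smul_notMem_range k.2 g⟩
  one_smul k := Subtype.ext (by
    change P.ι 1 * k.1 = k.1
    rw [map_one, one_mul])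
  mul_smul g h k := Subtype.ext (by
    change P.ι (g * h) * k.1 = P.ι g * (P.ι h * k.1)
    rw [map_mul, mul_assoc])

/-- The restriction of a left-invariant probability measure without atoms on `K` is an invariant
probability measure on the conull set of generic elements. -/
theorem exists_measure_generic [Countable G] [IsTopologicalGroup K] [CompactSpace K] [T2Space K]
    [MeasurableSpace K] [BorelSpace K] :
    ∃ ν : Measure P.Generic, IsProbabilityMeasure ν ∧
      ∀ g : G, MeasurePreserving (fun k : P.Generic => g • k) ν ν := by
  -- `1` is not isolated in `K`, so Haar measure has no atoms and the image of `G` is null.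
  have hne : (𝓝[≠] (1 : K)).NeBot := by
    rw [← mem_closure_iff_nhdsWithin_neBot, mem_closure_iff_nhds]
    intro U hU
    obtain ⟨n, hn⟩ := P.basis U hU
    obtain ⟨v, hv, hv'⟩ := P.exists_mem_notMem n
    refine ⟨v, hn hv, ?_⟩
    rintro rfl
    exact hv' (one_mem _)
  let κ : Measure K := Measure.haarMeasure ⊤
  have hκ : κ Set.univ = 1 := Measure.haarMeasure_self (K₀ := ⊤)
  have hcount : (Set.range P.ι).Countable := Set.countable_range _
  have hms : MeasurableSet {k : K | k ∉ Set.range P.ι} := hcount.measurableSet.compl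
  have hemb : MeasurableEmbedding (Subtype.val : P.Generic → K) :=
    MeasurableEmbedding.subtype_coe hms
  have hsmul : ∀ g : G, Measurable fun k : P.Generic => g • k := fun g =>
    measurable_comap_iff.2 ((measurable_const_mul (P.ι g)).comp hemb.measurable)
  refine ⟨κ.comap (Subtype.val : P.Generic → K), ⟨?_⟩, fun g => ⟨hsmul g, ?_⟩⟩
  · rw [hemb.comap_apply, Set.image_univ]
    have h0 : κ (Set.range P.ι) = 0 := hcount.measure_zero κ
    have h1 : Set.range (Subtype.val : P.Generic → K) = (Set.range P.ι)ᶜ := Subtype.range_val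
    have : IsProbabilityMeasure κ := ⟨hκ⟩
    rw [h1, prob_compl_eq_one_iff hcount.measurableSet, h0]
  · ext s hs
    rw [Measure.map_apply (hsmul g) hs, hemb.comap_apply, hemb.comap_apply]
    have : (Subtype.val : P.Generic → K) '' ((fun k : P.Generic => g • k) ⁻¹' s)
        = (P.ι g * ·) ⁻¹' (Subtype.val '' s) := by
      ext k
      constructor
      · rintro ⟨x, hx, rfl⟩
        exact ⟨g • x, hx, rfl⟩
      · rintro ⟨y, hy, hyk⟩
        refine ⟨g⁻¹ • y, ?_, ?_⟩
        · rwa [Set.mem_preimage, smul_inv_smul]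
        · change P.ι g⁻¹ * y.1 = k
          rw [hyk, map_inv, inv_mul_cancel_left]
    rw [this, measure_preimage_mul]

variable [IsTopologicalGroup K] [CompactSpace K] [T2Space K] [Nontrivial G] {c : ℕ → G}

/-- The free Toeplitz subshift generated by `word k`, for a generic `k`. -/
noncomputable def subshift (hc : ∀ g m, ∃ n ≥ m, c n = g) (k : P.Generic) :
    FreeToeplitzSubshift G :=
  ⟨P.orbitClosure c k.1, P.isFreeToeplitz_orbitClosure hc k.2⟩

/-- `k ↦ subshift k` is measurable: the subshift meets a given
open set for an open set of parameters `k`. -/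
theorem measurable_subshift [Countable G] [MeasurableSpace K] [BorelSpace K]
    (hc : ∀ g m, ∃ n ≥ m, c n = g) : Measurable (P.subshift hc) := by
  refine measurable_comap_iff.2 ?_
  have hcont : ∀ g : G, Continuous fun k : P.Generic => shift g (P.word c k.1) := fun g =>
    (continuous_shift g).comp <| continuous_pi fun h => continuous_iff_continuousAt.2 fun k =>
      ContinuousAt.comp (g := P.rigidFun c)
        (P.continuousAt_rigidFun c (P.mem_regularSet (P.smul_notMem_range k.2 h)))
        ((continuous_const_mul (P.ι h)).comp continuous_subtype_val).continuousAt
  have hhit : ∀ U : Set (G → Bool), IsOpen U →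
      MeasurableSet {k : P.Generic | ((P.orbitClosure c k.1 : Set (G → Bool)) ∩ U).Nonempty} := by
    intro U hU
    have : {k : P.Generic | ((P.orbitClosure c k.1 : Set (G → Bool)) ∩ U).Nonempty}
        = ⋃ g : G, {k | shift g (P.word c k.1) ∈ U} := by
      ext k
      rw [Set.mem_ofPred_eq, coe_orbitClosure, closure_inter_open_nonempty_iff hU]
      simp [Set.Nonempty]
    rw [this]
    exact (isOpen_iUnion fun g => hU.preimage (hcont g)).measurableSet
  have hbasis := (isTopologicalBasis_isClopen (X := G → Bool)).nonemptyCompacts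
  change @Measurable _ _ _ (borel _) _
  rw [hbasis.borel_eq_generateFrom]
  refine measurable_generateFrom ?_
  rintro _ ⟨u, ⟨hu, -, hclopen⟩, rfl⟩
  -- Since `⋃₀ u` is clopen, `L ⊆ ⋃₀ u` says that `L` misses an open set.
  have hV : IsClopen (⋃₀ u) := by
    rw [Set.sUnion_eq_biUnion]
    exact hu.isClopen_biUnion fun U hU => hclopen hU
  have : (Subtype.val ∘ P.subshift hc) ⁻¹'
      {L : NonemptyCompacts (G → Bool) | ↑L ⊆ ⋃₀ u ∧ ∀ U ∈ u, (↑L ∩ U).Nonempty}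
      = {k | ((P.orbitClosure c k.1 : Set (G → Bool)) ∩ (⋃₀ u)ᶜ).Nonempty}ᶜ ∩
        ⋂ U ∈ u, {k | ((P.orbitClosure c k.1 : Set (G → Bool)) ∩ U).Nonempty} := by
    ext k
    simp only [Set.mem_preimage, Set.mem_ofPred_eq, Set.mem_inter_iff, Set.mem_compl_iff,
      Set.inter_compl_nonempty_iff, not_not, Set.mem_iInter]
    rfl
  rw [this]
  exact (hhit _ hV.compl.isOpen).compl.inter
    (MeasurableSet.biInter hu.countable fun U hU => hhit U (hclopen hU).isOpen)

end ProfiniteChain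

end RandomSubshift

/-! ### Non-amenability of conjugacy -/

theorem IsAmenableGroup.center (G : Type*) [Group G] [Countable G] :
    IsAmenableGroup (Subgroup.center G) := by
  let _ : CommGroup (Subgroup.center G) :=
    { (inferInstance : Group (Subgroup.center G)) with
      mul_comm := fun a b => Subtype.ext ((Subgroup.mem_center_iff.1 b.2 a.1)) }
  exact IsAmenableGroup.of_comm

/-- A sequence that takes every value infinitely often. -/
theorem exists_forall_exists_ge_eq (α : Type*) [Countable α] [Nonempty α] :
    ∃ c : ℕ → α, ∀ a m, ∃ n ≥ m, c n = a := by
  obtain ⟨e, he⟩ := exists_surjective_nat α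
  refine ⟨fun n => e n.unpair.1, fun a m => ?_⟩
  obtain ⟨i, rfl⟩ := he a
  exact ⟨Nat.pair i m, Nat.right_le_pair i m, by simp⟩

theorem theorem1p2 {G : Type*} [Group G] [Countable G] [Group.ResiduallyFinite G]
    (hG : ¬ IsAmenableGroup G) :
    ¬ IsHyperfinite (conjugacy G) ∧
      ∃ μ : Measure (FreeToeplitzSubshift G),
        IsProbabilityMeasure μ ∧ ¬ IsMuAmenable (conjugacy G) μ := by
  have hinf : Infinite G := by
    by_contra h
    have := not_infinite_iff_finite.1 h
    exact hG (IsAmenableGroup.of_finite G)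
  obtain ⟨K, _, _, _, _, _, ⟨P⟩⟩ := exists_profiniteChain G
  obtain ⟨c, hc⟩ := exists_forall_exists_ge_eq G
  obtain ⟨ψ, hψ, hE⟩ := exists_enumeration_conjugacy G
  let _ : MeasurableSpace K := borel K
  have _ : BorelSpace K := ⟨rfl⟩
  obtain ⟨ν, hν, hinv⟩ := P.exists_measure_generic
  have hΦ := P.measurable_subshift hc
  have key : ¬ IsMuAmenable (conjugacy G) (ν.map (P.subshift hc)) := fun h =>
    hG <| IsAmenableGroup.of_isMuAmenable (IsAmenableGroup.center G) hψ hE hinv hΦ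
      (fun g k => P.conjugate_orbitClosure c g k.1)
      (fun g k hgk => P.mem_center_of_orbitClosure_eq hc (congrArg Subtype.val hgk)) h
  exact ⟨fun h => key (h.isMuAmenable hψ hE _), _,
    Measure.isProbabilityMeasure_map hΦ.aemeasurable, key⟩
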